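/- Let $m\ge 2$, $0=\xi_1<\xi_2<\dots<\xi_m=1$, $\beta_k\ge 0$, let $Q\ge 0$ be a bounded measurable function on $[0,1]$ and let $R$ be a symmetric positive definite real $m\times m$ matrix. Write $\beta=\mathrm{diag}(\beta_1,\dots,\beta_m)$ and $S=[0,1]^2$. *The rod.* For an initial temperature $z^0\in L^2(0,1)$ and a control $u=[u_1,\dots,u_m]'\in L^2_{loc}([0,\infty);\mathbb R^m)$, consider a rod heated/cooled at the points $\xi_k$: $$\frac{\partial z}{\partial t}=\frac{\partial^2 z}{\partial x^2}\ \ (x\ne\xi_k),\qquad z(\xi_k^-,t)=z(\xi_k^+,t)\ \ (1<k<m),\qquad \frac{\partial z}{\partial x}(\xi_k^-,t)-\frac{\partial z}{\partial x}(\xi_k^+,t)=\beta_ku_k(t)\ \ (1\le k\le m),\qquad z(x,0)=z^0(x),$$ with $\partial z/\partial x=0$ outside $[0,1]$. These equations are understood weakly: a trajectory is a pair $(u,z)$ with $z\in C([0,\infty);L^2(0,1))$, $z(\cdot,0)=z^0$, such that for every $\psi\in C^2[0,1]$ with $\psi'(0)=\psi'(1)=0$ and every $t\ge0$ $$\int_0^1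 z(x,t)\psi(x)\,dx=\int_0^1 z^0(x)\psi(x)\,dx+\int_0^t\Big(\int_0^1 z(x,s)\psi''(x)\,dx+\sum_{k=1}^m\beta_ku_k(s)\psi(\xi_k)\Big)ds .$$ Its cost is $J(u,z)=\int_0^\infty\big(\int_0^1 z(x,t)Q(x)z(x,t)\,dx+u(t)'Ru(t)\big)dt\in[0,\infty]$. *The Riccati PDE.* Let $P$ be continuous on $S$ with $P(x_1,x_2)=P(x_2,x_1)$, put $\bar P(x)=[P(\xi_1,x),\dots,P(\xi_m,x)]'$, and suppose that $P$ is a weak solution of $$\nabla^2P(x_1,x_2)+\delta(x_1-x_2)Q(x_1)=(\beta\bar P(x_1))'R^{-1}\beta\bar P(x_2)$$ with Neumann boundary conditions, that is, for all $\psi$ as above, $$\iint_S P(x_1,x_2)\big(\psi''(x_1)\psi(x_2)+\psi(x_1)\psi''(x_2)\big)dA+\int_0^1Q\psi^2\,dx-\iint_S(\beta\bar P(x_1))'R^{-1}\beta\bar P(x_2)\,\psi(x_1)\psi(x_2)\,dA=0 .$$ Let $K(x)=-R^{-1}\beta\bar P(x)$ and let $z^0\in L^2(0,1)$. Then: 1.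 The closed-loop system with the linear state feedback $u(t)=\int_0^1K(x)z(x,t)\,dx$ has a trajectory starting at $z^0$. 2. If a closed-loop trajectory from $z^0$ satisfies $z(\cdot,t)\to0$ in $L^2(0,1)$ as $t\to\infty$, then it minimizes $J$ among all trajectories from $z^0$ that tend to $0$ in $L^2(0,1)$, and the optimal cost is $\iint_S z^0(x_1)P(x_1,x_2)z^0(x_2)\,dA\ge 0$. 3. If $\int_0^1Q\,dx>0$ and $P$ is positive semidefinite, i.e. $\iint_S f(x_1)P(x_1,x_2)f(x_2)\,dA\ge0$ for all $f\in L^2(0,1)$, then every closed-loop trajectory from $z^0$ satisfies $z(\cdot,t)\to0$ in $L^2(0,1)$ and minimizes $J$ among all trajectories from $z^0$, and the optimal cost is $\iint_S z^0(x_1)P(x_1,x_2)z^0(x_2)\,dA$. -/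

import Mathlib

open MeasureTheory Set Filter Topology

namespace RodLQR

/-- Lebesgue measure on the rod `[0,1]`. -/
noncomputable abbrev rodMeasure : Measure ℝ := volume.restrict (Icc (0 : ℝ) 1)

/-- Temperature profiles of finite energy: the real Hilbert space `L²(0,1)`. -/
abbrev RodState : Type := Lp ℝ 2 rodMeasure

/-- `C²` test functions on `[0,1]` with Neumann boundary conditions. (Every `C²` function on
`[0,1]` is the restriction of a `C²` function on `ℝ`.) -/
structure IsNeumannTest (ψ : ℝ → ℝ) : Prop where
  contDiff : ContDiff ℝ 2 ψ
  left : deriv ψ 0 = 0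
  right : deriv ψ 1 = 0

/-- `z`, with values in `L²(0,1)`, is a (weak) solution for `t ≥ 0` of the rod equations
`z_t = z_xx` off the points `ξ_k`, `z` continuous across the `ξ_k`,
`z_x(ξ_k⁻,t) - z_x(ξ_k⁺,t) = β_k u_k(t)` (with `z_x = 0` outside `[0,1]`), `z(·,0) = z₀`,
driven by the locally square integrable control `u`.
Multiplying the heat equation by a Neumann test function `ψ` and integrating by parts twice on
every `[ξ_k, ξ_{k+1}]`, the jump conditions contribute the terms `β_k u_k(t) ψ(ξ_k)`; see
`IsClassicalSolution.weak_identity` below. -/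
structure IsTrajectory {m : ℕ} (ξ β : Fin (m + 1) → ℝ) (z₀ : RodState)
    (u : ℝ → Fin (m + 1) → ℝ) (z : ℝ → RodState) : Prop where
  control_memLp : ∀ T : ℝ, MemLp u 2 (volume.restrict (Ioc 0 T))
  continuousOn : ContinuousOn z (Ici 0)
  initial : z 0 = z₀
  weak : ∀ ψ : ℝ → ℝ, IsNeumannTest ψ → ∀ t : ℝ, 0 ≤ t →
    ∫ x, z t x * ψ x ∂rodMeasure = (∫ x, z₀ x * ψ x ∂rodMeasure) +
      ∫ s in (0 : ℝ)..t, ((∫ x, z s x * deriv (deriv ψ) x ∂rodMeasure) +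
        ∑ k, β k * u s k * ψ (ξ k))

/-- The quadratic cost `∫₀^∞ (∫₀¹ z Q z dx + u' R u) dt`, as an element of `[0,∞]`. -/
noncomputable def cost {m : ℕ} (Q : ℝ → ℝ) (R : Matrix (Fin (m + 1)) (Fin (m + 1)) ℝ)
    (u : ℝ → Fin (m + 1) → ℝ) (z : ℝ → RodState) : ENNReal :=
  ∫⁻ t in Ioi (0 : ℝ), ENNReal.ofReal
    ((∫ x, z t x * Q x * z t x ∂rodMeasure) + u t ⬝ᵥ R.mulVec (u t))

/-- `∬ f(x₁) P(x₁,x₂) f(x₂) dx₁ dx₂` over the unit square. -/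
noncomputable def quadForm (P : ℝ → ℝ → ℝ) (f : RodState) : ℝ :=
  ∫ x₁, ∫ x₂, f x₁ * P x₁ x₂ * f x₂ ∂rodMeasure ∂rodMeasure

/-- `P̄(x) = [P(ξ_1,x), …, P(ξ_m,x)]'`. -/
def Pbar {m : ℕ} (ξ : Fin (m + 1) → ℝ) (P : ℝ → ℝ → ℝ) (x : ℝ) : Fin (m + 1) → ℝ :=
  fun k => P (ξ k) x

/-- The feedback gain `K(x) = -R⁻¹ β P̄(x)`, where `β` is the diagonal matrix of the `β_k`. -/
noncomputable def gain {m : ℕ} (ξ β : Fin (m + 1) → ℝ)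
    (R : Matrix (Fin (m + 1)) (Fin (m + 1)) ℝ) (P : ℝ → ℝ → ℝ) (x : ℝ) : Fin (m + 1) → ℝ :=
  -((R⁻¹ * Matrix.diagonal β).mulVec (Pbar ξ P x))

/-- The state feedback `u(t) = ∫₀¹ K(x) z(x,t) dx`. -/
noncomputable def feedback {m : ℕ} (K : ℝ → Fin (m + 1) → ℝ) (z : ℝ → RodState) :
    ℝ → Fin (m + 1) → ℝ :=
  fun t k => ∫ x, K x k * z t x ∂rodMeasure

/-- `P` is a weak solution of the Riccati PDE
`∇²P(x₁,x₂) + δ(x₁-x₂) Q(x₁) = (β P̄(x₁))' R⁻¹ β P̄(x₂)` on the unit square with Neumann boundary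
conditions: the equation is tested with `ψ(x₁) ψ(x₂)` and the Laplacian is moved onto the test
function by parts. -/
def IsWeakRiccatiSolution {m : ℕ} (ξ β : Fin (m + 1) → ℝ) (Q : ℝ → ℝ)
    (R : Matrix (Fin (m + 1)) (Fin (m + 1)) ℝ) (P : ℝ → ℝ → ℝ) : Prop :=
  ∀ ψ : ℝ → ℝ, IsNeumannTest ψ →
    (∫ x₁, ∫ x₂, P x₁ x₂ * (deriv (deriv ψ) x₁ * ψ x₂ + ψ x₁ * deriv (deriv ψ) x₂)
        ∂rodMeasure ∂rodMeasure)
      + (∫ x, Q x * ψ x * ψ x ∂rodMeasure)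
      - (∫ x₁, ∫ x₂, ((Matrix.diagonal β).mulVec (Pbar ξ P x₁) ⬝ᵥ
          R⁻¹.mulVec ((Matrix.diagonal β).mulVec (Pbar ξ P x₂))) * (ψ x₁ * ψ x₂)
        ∂rodMeasure ∂rodMeasure) = 0

/-- Classical solutions of the rod equations, with derivatives continuous up to the ends of every
piece `[ξ_i, ξ_{i+1}]`. Here `zx i`, `zxx i` are the space derivatives on the `i`-th piece. -/
structure IsClassicalSolution {m : ℕ} (ξ β : Fin (m + 1) → ℝ) (z₀ : ℝ → ℝ)
    (u : ℝ → Fin (m + 1) → ℝ) (z : ℝ → ℝ → ℝ) (zx zxx : Fin m → ℝ → ℝ → ℝ) : Prop where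
  initial : ∀ x ∈ Icc (0 : ℝ) 1, z x 0 = z₀ x
  cont : ContinuousOn (fun p : ℝ × ℝ => z p.1 p.2) (Icc 0 1 ×ˢ Ici 0)
  cont_zxx : ∀ i : Fin m, ContinuousOn (fun p : ℝ × ℝ => zxx i p.1 p.2)
    (Icc (ξ i.castSucc) (ξ i.succ) ×ˢ Ici 0)
  hasDeriv_x : ∀ i : Fin m, ∀ t : ℝ, 0 ≤ t → ∀ x ∈ Icc (ξ i.castSucc) (ξ i.succ),
    HasDerivWithinAt (fun y => z y t) (zx i x t) (Icc (ξ i.castSucc) (ξ i.succ)) x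
  hasDeriv_xx : ∀ i : Fin m, ∀ t : ℝ, 0 ≤ t → ∀ x ∈ Icc (ξ i.castSucc) (ξ i.succ),
    HasDerivWithinAt (fun y => zx i y t) (zxx i x t) (Icc (ξ i.castSucc) (ξ i.succ)) x
  heat : ∀ i : Fin m, ∀ t : ℝ, 0 ≤ t → ∀ x ∈ Icc (ξ i.castSucc) (ξ i.succ),
    HasDerivWithinAt (fun s => z x s) (zxx i x t) (Ici 0) t
  jump : ∀ t : ℝ, 0 ≤ t → ∀ k : Fin (m + 1),
    β k * u t k =
      (Fin.cons 0 (fun i : Fin m => zx i (ξ i.succ) t) : Fin (m + 1) → ℝ) k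
        - (Fin.snoc (fun i : Fin m => zx i (ξ i.castSucc) t) 0 : Fin (m + 1) → ℝ) k

/-- Adding up integrals over the pieces `[ξ_i, ξ_{i+1}]`. -/
theorem sum_pieces {m : ℕ} (ξ : Fin (m + 1) → ℝ) (f : ℝ → ℝ)
    (hf : ∀ a b : ℝ, a ∈ range ξ → b ∈ range ξ → IntervalIntegrable f volume a b) :
    ∫ x in (ξ 0)..(ξ (Fin.last m)), f x
      = ∑ i : Fin m, ∫ x in (ξ i.castSucc)..(ξ i.succ), f x := by
  induction m with
  | zero => simp
  | succ n ih =>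
    rw [Fin.sum_univ_castSucc]
    have h := ih (fun i => ξ i.castSucc) (fun a b ha hb => hf a b
      (by obtain ⟨i, rfl⟩ := ha; exact ⟨_, rfl⟩) (by obtain ⟨i, rfl⟩ := hb; exact ⟨_, rfl⟩))
    simp only [Fin.castSucc_zero] at h
    simp only [Fin.succ_castSucc]
    rw [← h, Fin.succ_last]
    exact (intervalIntegral.integral_add_adjacent_intervals
      (hf _ _ ⟨_, rfl⟩ ⟨_, rfl⟩) (hf _ _ ⟨_, rfl⟩ ⟨_, rfl⟩)).symm

/-- A classical solution satisfies the weak identity that defines `IsTrajectory`. -/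
theorem IsClassicalSolution.weak_identity {m : ℕ} {ξ β : Fin (m + 1) → ℝ} {z₀ : ℝ → ℝ}
    {u : ℝ → Fin (m + 1) → ℝ} {z : ℝ → ℝ → ℝ} {zx zxx : Fin m → ℝ → ℝ → ℝ}
    (hξ : StrictMono ξ) (hξ0 : ξ 0 = 0) (hξ1 : ξ (Fin.last m) = 1)
    (h : IsClassicalSolution ξ β z₀ u z zx zxx) {ψ : ℝ → ℝ} (hψ : IsNeumannTest ψ)
    {t : ℝ} (ht : 0 ≤ t) :
    ∫ x in (0 : ℝ)..1, z x t * ψ x = (∫ x in (0 : ℝ)..1, z₀ x * ψ x) +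
      ∫ s in (0 : ℝ)..t, ((∫ x in (0 : ℝ)..1, z x s * deriv (deriv ψ) x) +
        ∑ k, β k * u s k * ψ (ξ k)) := by
  have hmem : ∀ k, ξ k ∈ Icc (0 : ℝ) 1 := fun k =>
    ⟨hξ0 ▸ hξ.monotone (Fin.zero_le k), hξ1 ▸ hξ.monotone (Fin.le_last k)⟩
  have hlt : ∀ i : Fin m, ξ i.castSucc ≤ ξ i.succ := fun i =>
    hξ.monotone (Fin.castSucc_lt_succ).le
  have hsub : ∀ i : Fin m, Icc (ξ i.castSucc) (ξ i.succ) ⊆ Icc (0 : ℝ) 1 := fun i x hx =>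
    ⟨(hmem _).1.trans hx.1, hx.2.trans (hmem _).2⟩
  have hψ1 : ContDiff ℝ 1 (deriv ψ) := (contDiff_succ_iff_deriv.1 (by
    simpa using (show ContDiff ℝ (1 + 1) ψ by simpa [one_add_one_eq_two] using hψ.contDiff))).2.2
  have hψc : Continuous ψ := hψ.contDiff.continuous
  have hψ1c : Continuous (deriv ψ) := hψ1.continuous
  have hψ2c : Continuous (deriv (deriv ψ)) := hψ1.continuous_deriv le_rfl
  have hdψ : ∀ x, HasDerivAt ψ (deriv ψ x) x := fun x =>
    (hψ.contDiff.differentiable (by norm_num) x).hasDerivAt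
  have hdψ1 : ∀ x, HasDerivAt (deriv ψ) (deriv (deriv ψ) x) x := fun x =>
    (hψ1.differentiable (by norm_num) x).hasDerivAt
  have hzc : ∀ s, 0 ≤ s → ContinuousOn (fun x => z x s) (Icc 0 1) := fun s hs =>
    h.cont.comp (f := fun x : ℝ => (x, s)) (by fun_prop) (fun x hx => ⟨hx, hs⟩)
  have hzxxc : ∀ i s, 0 ≤ s →
      ContinuousOn (fun x => zxx i x s) (Icc (ξ i.castSucc) (ξ i.succ)) := fun i s hs =>
    (h.cont_zxx i).comp (f := fun x : ℝ => (x, s)) (by fun_prop) (fun x hx => ⟨hx, hs⟩)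
  have split : ∀ s, 0 ≤ s → ∀ g : ℝ → ℝ, Continuous g → ∫ x in (0 : ℝ)..1, z x s * g x
      = ∑ i : Fin m, ∫ x in (ξ i.castSucc)..(ξ i.succ), z x s * g x := by
    intro s hs g hg
    rw [← sum_pieces, hξ0, hξ1]
    rintro a b ⟨i, rfl⟩ ⟨j, rfl⟩
    refine ContinuousOn.intervalIntegrable ?_
    refine ((hzc s hs).mul hg.continuousOn).mono ?_
    exact (convex_Icc (0 : ℝ) 1).ordConnected.uIcc_subset (hmem i) (hmem j)
  -- spatial identity on one time slice
  have slice : ∀ s, 0 ≤ s → ∑ i : Fin m, ∫ x in (ξ i.castSucc)..(ξ i.succ), zxx i x s * ψ x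
      = (∫ x in (0 : ℝ)..1, z x s * deriv (deriv ψ) x) + ∑ k, β k * u s k * ψ (ξ k) := by
    intro s hs
    have piece : ∀ i : Fin m, ∫ x in (ξ i.castSucc)..(ξ i.succ), zxx i x s * ψ x
        = (∫ x in (ξ i.castSucc)..(ξ i.succ), z x s * deriv (deriv ψ) x)
          + ((zx i (ξ i.succ) s * ψ (ξ i.succ) - zx i (ξ i.castSucc) s * ψ (ξ i.castSucc))
          - (z (ξ i.succ) s * deriv ψ (ξ i.succ)
            - z (ξ i.castSucc) s * deriv ψ (ξ i.castSucc))) := by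
      intro i
      have hab := hlt i
      have c1 : ContinuousOn (fun x => zxx i x s * ψ x) (Icc (ξ i.castSucc) (ξ i.succ)) :=
        (hzxxc i s hs).mul hψc.continuousOn
      have c2 : ContinuousOn (fun x => z x s * deriv (deriv ψ) x)
          (Icc (ξ i.castSucc) (ξ i.succ)) :=
        ((hzc s hs).mono (hsub i)).mul hψ2c.continuousOn
      have ii1 := c1.intervalIntegrable_of_Icc (μ := volume) hab
      have ii2 := c2.intervalIntegrable_of_Icc (μ := volume) hab
      have hd : ∀ x ∈ Icc (ξ i.castSucc) (ξ i.succ),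
          HasDerivWithinAt (fun y => zx i y s * ψ y - z y s * deriv ψ y)
            (zxx i x s * ψ x - z x s * deriv (deriv ψ) x)
            (Icc (ξ i.castSucc) (ξ i.succ)) x := by
        intro x hx
        have := (((h.hasDeriv_xx i s hs x hx).mul (hdψ x).hasDerivWithinAt).sub
          ((h.hasDeriv_x i s hs x hx).mul (hdψ1 x).hasDerivWithinAt))
        refine this.congr_deriv ?_
        ring
      have key := intervalIntegral.integral_eq_sub_of_hasDerivAt_of_le hab
        (f := fun y => zx i y s * ψ y - z y s * deriv ψ y)
        (f' := fun x => zxx i x s * ψ x - z x s * deriv (deriv ψ) x)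
        (fun x hx => (hd x hx).continuousWithinAt)
        (fun x hx => (hd x (Ioo_subset_Icc_self hx)).hasDerivAt (Icc_mem_nhds hx.1 hx.2))
        (ii1.sub ii2)
      rw [intervalIntegral.integral_sub ii1 ii2] at key
      linarith
    rw [split s hs _ hψ2c, Finset.sum_congr rfl (fun i _ => piece i), Finset.sum_add_distrib,
      Finset.sum_sub_distrib]
    have tele : ∑ i : Fin m, (z (ξ i.succ) s * deriv ψ (ξ i.succ)
            - z (ξ i.castSucc) s * deriv ψ (ξ i.castSucc)) = 0 := by
      have e1 := Fin.sum_univ_succ (fun k => z (ξ k) s * deriv ψ (ξ k))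
      have e2 := Fin.sum_univ_castSucc (fun k => z (ξ k) s * deriv ψ (ξ k))
      simp only [hξ0, hξ1, hψ.left, hψ.right, mul_zero, zero_add, add_zero] at e1 e2
      rw [Finset.sum_sub_distrib, ← e1, ← e2, sub_self]
    have jmp : ∑ k, β k * u s k * ψ (ξ k) = ∑ i : Fin m,
        (zx i (ξ i.succ) s * ψ (ξ i.succ) - zx i (ξ i.castSucc) s * ψ (ξ i.castSucc)) := by
      simp only [h.jump s hs, sub_mul]
      rw [Finset.sum_sub_distrib, Finset.sum_sub_distrib, Fin.sum_univ_succ,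
        Fin.sum_univ_castSucc (fun k => (Fin.snoc (fun i : Fin m => zx i (ξ i.castSucc) s) 0 :
          Fin (m + 1) → ℝ) k * ψ (ξ k))]
      simp
    rw [tele, jmp]
    ring
  have hz0 : ∫ x in (0 : ℝ)..1, z₀ x * ψ x = ∫ x in (0 : ℝ)..1, z x 0 * ψ x := by
    refine intervalIntegral.integral_congr (fun x hx => ?_)
    rw [uIcc_of_le zero_le_one] at hx
    simp only [h.initial x hx]
  rw [hz0, split t ht _ hψc, split 0 le_rfl _ hψc]
  have time : ∀ i : Fin m,
      ContinuousOn (fun p : ℝ × ℝ => zxx i p.1 p.2 * ψ p.1)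
        (uIcc (ξ i.castSucc) (ξ i.succ) ×ˢ uIcc 0 t) := by
    intro i
    rw [uIcc_of_le (hlt i), uIcc_of_le ht]
    exact ((h.cont_zxx i).mono (prod_mono le_rfl Icc_subset_Ici_self)).mul
      (hψc.comp continuous_fst).continuousOn
  have prod_int : ∀ i : Fin m, Integrable (Function.uncurry fun x s : ℝ => zxx i x s * ψ x)
      ((volume.restrict (Ioc (ξ i.castSucc) (ξ i.succ))).prod (volume.restrict (Ioc 0 t))) := by
    intro i
    rw [Measure.prod_restrict]
    refine IntegrableOn.mono_set (t := uIcc (ξ i.castSucc) (ξ i.succ) ×ˢ uIcc 0 t)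
      ((time i).integrableOn_compact (isCompact_uIcc.prod isCompact_uIcc)) ?_
    rw [uIcc_of_le (hlt i), uIcc_of_le ht]
    exact prod_mono Ioc_subset_Icc_self Ioc_subset_Icc_self
  have piece_t : ∀ i : Fin m, ∫ x in (ξ i.castSucc)..(ξ i.succ), z x t * ψ x
      = (∫ x in (ξ i.castSucc)..(ξ i.succ), z x 0 * ψ x)
        + ∫ s in (0 : ℝ)..t, ∫ x in (ξ i.castSucc)..(ξ i.succ), zxx i x s * ψ x := by
    intro i
    have swap : ∫ s in (0 : ℝ)..t, ∫ x in (ξ i.castSucc)..(ξ i.succ), zxx i x s * ψ x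
        = ∫ x in (ξ i.castSucc)..(ξ i.succ), ∫ s in (0 : ℝ)..t, zxx i x s * ψ x := by
      simp only [intervalIntegral.integral_of_le (hlt i), intervalIntegral.integral_of_le ht]
      exact (integral_integral_swap (prod_int i)).symm
    rw [swap]
    have ftc : ∀ x ∈ Icc (ξ i.castSucc) (ξ i.succ),
        ∫ s in (0 : ℝ)..t, zxx i x s * ψ x = z x t * ψ x - z x 0 * ψ x := by
      intro x hx
      have cx : ContinuousOn (fun s => zxx i x s) (Icc 0 t) :=
        (h.cont_zxx i).comp (f := fun s : ℝ => (x, s)) (by fun_prop) (fun s hs => ⟨hx, hs.1⟩)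
      rw [intervalIntegral.integral_mul_const,
        intervalIntegral.integral_eq_sub_of_hasDerivAt_of_le ht (f := fun s => z x s)
          (fun s hs => ((h.heat i s hs.1 x hx).continuousWithinAt).mono Icc_subset_Ici_self)
          (fun s hs => (h.heat i s hs.1.le x hx).hasDerivAt (Ici_mem_nhds hs.1))
          (cx.intervalIntegrable_of_Icc ht)]
      ring
    rw [intervalIntegral.integral_congr (g := fun x => z x t * ψ x - z x 0 * ψ x)
      (fun x hx => ftc x (by rwa [uIcc_of_le (hlt i)] at hx)),
      intervalIntegral.integral_sub]
    · ring
    · exact (((hzc t ht).mono (hsub i)).mul hψc.continuousOn).intervalIntegrable_of_Icc (hlt i)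
    · exact (((hzc 0 le_rfl).mono (hsub i)).mul hψc.continuousOn).intervalIntegrable_of_Icc
        (hlt i)
  rw [Finset.sum_congr rfl (fun i _ => piece_t i), Finset.sum_add_distrib,
    ← intervalIntegral.integral_finsetSum]
  · congr 1
    refine intervalIntegral.integral_congr (fun s hs => ?_)
    rw [uIcc_of_le ht] at hs
    exact slice s hs.1
  · intro i _
    rw [intervalIntegrable_iff, uIoc_of_le ht]
    have := (prod_int i).integral_prod_right
    simp only [intervalIntegral.integral_of_le (hlt i)]
    exact this

end RodLQR

open RodLQR

/-!
The rod is diagonalised by the Neumann eigenfunctions `1, √2 cos(πx), √2 cos(2πx), …`, which form a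
Hilbert basis of `L²(0,1)` (`cosBasis`). In these coordinates a trajectory is a sequence of scalar
equations `c_n' = -λ_n c_n + b_n · u`, with `λ_n = (nπ)²` and `b_n = (β_k φ_n(ξ_k))_k` bounded in
`n` (`IsModalTrajectory`). The two formulations are equivalent because the cosine series of a
Neumann test function converges pointwise (`hasSum_cosine_series`), so that a closed-loop
trajectory can be obtained from a fixed point of Duhamel's formula (`exists_modal_solution`): the
control operator is unbounded, but `∑ (λ_n + μ)⁻²` is finite, and small for large `μ`.

Polarised on pairs of eigenfunctions, the weak Riccati equation becomes the Lyapunov equation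
`(λ_i + λ_j) P_ij = D_ij`, where `D` is the bounded operator "multiplication by `Q`, minus
`G R⁻¹ G'`", with `G_k = β_k P(ξ_k, ·)` (`IsWeakRiccatiSolution.lyapunov`). It follows that
`‖P φ_i‖ = O(1 / λ_i)`. This regularity is the crucial point: although `P` is only assumed
continuous, the cosine series of `x ↦ P(x, ·)` converges absolutely in `L²(0,1)`, and at `x = ξ_k`
it gives `∑ b_ik P φ_i = G_k` (`hasSum_inputCoeff_smul`). One may then differentiate `⟨P w, w⟩`
along the truncations of a trajectory to finitely many modes and pass to the limit
(`IsModalTrajectory.inner_map_eq`). Completing the square yields the energy identity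
`∫₀ᵗ (⟨w, Q w⟩ + v' R v) = ⟨P z₀, z₀⟩ - ⟨P w(t), w(t)⟩ + ∫₀ᵗ (v - K w)' R (v - K w)`
(`energy_identity`), which compares costs as soon as the terminal term tends to zero.

If `∫ Q > 0`, finite cost does force `w(t) → 0` (`IsModalTrajectory.tendsto_zero`). The control is
square integrable since `R` is coercive. For `n ≥ 1` the energy estimate
`c_n(t)² + λ_n ∫₀ᵗ c_n² ≤ c_n(0)² + O(1 / λ_n)` makes the damped part of the state square integrable
in time; by the finite observed energy `∫ ⟨w, Q w⟩` the mean value `c_0` is then square integrable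
as well. Each `c_n²` is integrable together with its derivative, hence tends to zero, and the same
estimate dominates the sum over `n`. When `P` is positive semidefinite the energy identity bounds
the closed-loop cost by `⟨P z₀, z₀⟩`, so this applies to the closed loop and to every competitor of
finite cost.
-/

namespace RodLQR

/-! ### The cosine basis of `L²(0,1)` -/

theorem memLp_continuousMap (f : C(ℝ, ℝ)) : MemLp f 2 rodMeasure := by
  obtain ⟨c, hc⟩ := isCompact_Icc.exists_bound_of_continuousOn (s := Icc (0 : ℝ) 1)
    f.continuous.continuousOn
  refine MemLp.of_bound f.continuous.aestronglyMeasurable c ?_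
  exact (ae_restrict_iff' measurableSet_Icc).2 (Eventually.of_forall fun x hx => hc x hx)

/-- The class in `L²(0,1)` of a continuous function on the line. -/
noncomputable def toState : C(ℝ, ℝ) →ₗ[ℝ] RodState where
  toFun f := (memLp_continuousMap f).toLp f
  map_add' f g := MemLp.toLp_add (memLp_continuousMap f) (memLp_continuousMap g)
  map_smul' c f := MemLp.toLp_const_smul c (memLp_continuousMap f)

theorem coeFn_toState (f : C(ℝ, ℝ)) : toState f =ᵐ[rodMeasure] f :=
  MemLp.coeFn_toLp (memLp_continuousMap f)

theorem inner_toState (g : RodState) (f : C(ℝ, ℝ)) :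
    inner ℝ (toState f) g = ∫ x, g x * f x ∂rodMeasure := by
  rw [L2.inner_def]
  refine integral_congr_ae ?_
  filter_upwards [coeFn_toState f] with x hx
  simp [hx]

theorem inner_toState_toState (f g : C(ℝ, ℝ)) :
    inner ℝ (toState f) (toState g) = ∫ x, g x * f x ∂rodMeasure := by
  rw [inner_toState]
  refine integral_congr_ae ?_
  filter_upwards [coeFn_toState g] with x hx
  simp [hx]

theorem integral_rodMeasure (f : ℝ → ℝ) : ∫ x, f x ∂rodMeasure = ∫ x in (0 : ℝ)..1, f x := by
  rw [intervalIntegral.integral_of_le zero_le_one, integral_Icc_eq_integral_Ioc]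

theorem norm_toState_le (f : C(ℝ, ℝ)) {c : ℝ} (hc : 0 ≤ c) (h : ∀ x ∈ Icc (0 : ℝ) 1, |f x| ≤ c) :
    ‖toState f‖ ≤ c := by
  have := Lp.norm_le_of_ae_bound (f := toState f) hc (by
    filter_upwards [coeFn_toState f, ae_restrict_mem measurableSet_Icc] with x hx hx'
    rw [hx]
    exact h x hx')
  simpa [measureUnivNNReal, Measure.real] using this

/-- Two continuous functions with the same class in `L²(0,1)` agree on `[0,1]`. -/
theorem eqOn_of_toState_eq {f g : C(ℝ, ℝ)} (h : toState f = toState g) :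
    EqOn f g (Icc 0 1) := by
  refine Measure.eqOn_Icc_of_ae_eq (μ := volume) zero_ne_one ?_ f.continuous.continuousOn
    g.continuous.continuousOn
  exact (coeFn_toState f).symm.trans (h ▸ coeFn_toState g)

/-- The Neumann eigenfunctions `1, √2 cos(πx), √2 cos(2πx), …`. -/
noncomputable def cosMode (n : ℕ) : C(ℝ, ℝ) where
  toFun x := (if n = 0 then 1 else √2) * Real.cos (n * Real.pi * x)
  continuous_toFun := by fun_prop

theorem cosMode_apply (n : ℕ) (x : ℝ) :
    cosMode n x = (if n = 0 then 1 else √2) * Real.cos (n * Real.pi * x) := rfl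

/-- The Neumann eigenvalues `(nπ)²`. -/
noncomputable def eigenvalue (n : ℕ) : ℝ := (n * Real.pi) ^ 2

theorem abs_cosMode_le (n : ℕ) (x : ℝ) : |cosMode n x| ≤ 2 := by
  rw [cosMode_apply, abs_mul]
  have h1 : |(if n = 0 then 1 else √2 : ℝ)| ≤ 2 := by
    split_ifs
    · norm_num
    · rw [abs_of_nonneg (Real.sqrt_nonneg _)]
      rw [Real.sqrt_le_left (by norm_num)]; norm_num
  calc _ ≤ 2 * 1 := mul_le_mul h1 (Real.abs_cos_le_one _) (abs_nonneg _) (by norm_num)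
    _ = 2 := by norm_num

theorem deriv_cosMode (n : ℕ) :
    deriv (cosMode n) = fun x => -((if n = 0 then 1 else √2) * (n * Real.pi)
      * Real.sin (n * Real.pi * x)) := by
  funext x
  have h : HasDerivAt (fun x : ℝ => n * Real.pi * x) (n * Real.pi) x := by
    simpa using (hasDerivAt_id x).const_mul (n * Real.pi)
  have := (h.cos).const_mul (if n = 0 then 1 else √2 : ℝ)
  refine (HasDerivAt.deriv (f := cosMode n) this).trans ?_
  ring

theorem deriv_deriv_cosMode (n : ℕ) :
    deriv (deriv (cosMode n)) = fun x => -eigenvalue n * cosMode n x := by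
  rw [deriv_cosMode]
  funext x
  have h : HasDerivAt (fun x : ℝ => n * Real.pi * x) (n * Real.pi) x := by
    simpa using (hasDerivAt_id x).const_mul (n * Real.pi)
  have := ((h.sin).const_mul ((if n = 0 then 1 else √2 : ℝ) * (n * Real.pi))).neg
  refine (HasDerivAt.deriv this).trans ?_
  rw [eigenvalue, cosMode_apply]
  ring

theorem isNeumannTest_cosMode (n : ℕ) : IsNeumannTest (cosMode n) where
  contDiff := by
    have : (cosMode n : ℝ → ℝ) = fun x => (if n = 0 then 1 else √2) * Real.cos (n * Real.pi * x) :=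
      rfl
    rw [this]
    fun_prop
  left := by simp [deriv_cosMode]
  right := by simp [deriv_cosMode, Real.sin_nat_mul_pi]

theorem IsNeumannTest.add {f g : ℝ → ℝ} (hf : IsNeumannTest f) (hg : IsNeumannTest g) :
    IsNeumannTest (f + g) where
  contDiff := hf.contDiff.add hg.contDiff
  left := by
    rw [deriv_add (hf.contDiff.differentiable (by norm_num) _)
      (hg.contDiff.differentiable (by norm_num) _), hf.left, hg.left, add_zero]
  right := by
    rw [deriv_add (hf.contDiff.differentiable (by norm_num) _)
      (hg.contDiff.differentiable (by norm_num) _), hf.right, hg.right, add_zero]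

theorem IsNeumannTest.contDiff_deriv {f : ℝ → ℝ} (hf : IsNeumannTest f) :
    ContDiff ℝ 1 (deriv f) :=
  (contDiff_succ_iff_deriv.1 (by
    simpa using (show ContDiff ℝ (1 + 1) f by simpa [one_add_one_eq_two] using hf.contDiff))).2.2

theorem IsNeumannTest.continuous_deriv_deriv {f : ℝ → ℝ} (hf : IsNeumannTest f) :
    Continuous (deriv (deriv f)) :=
  hf.contDiff_deriv.continuous_deriv le_rfl

/-- Two integrations by parts: the Neumann Laplacian is symmetric. -/
theorem IsNeumannTest.integral_deriv_deriv_mul {f g : ℝ → ℝ} (hf : IsNeumannTest f)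
    (hg : IsNeumannTest g) :
    ∫ x in (0 : ℝ)..1, deriv (deriv f) x * g x = ∫ x in (0 : ℝ)..1, f x * deriv (deriv g) x := by
  have d1 : ∀ {h : ℝ → ℝ}, IsNeumannTest h → ∀ x, HasDerivAt h (deriv h x) x := fun hh x =>
    (hh.contDiff.differentiable (by norm_num) x).hasDerivAt
  have d2 : ∀ {h : ℝ → ℝ}, IsNeumannTest h → ∀ x, HasDerivAt (deriv h) (deriv (deriv h) x) x :=
    fun hh x => (hh.contDiff_deriv.differentiable (by norm_num) x).hasDerivAt
  have key : ∀ x, HasDerivAt (fun x => deriv f x * g x - f x * deriv g x)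
      (deriv (deriv f) x * g x - f x * deriv (deriv g) x) x := fun x => by
    have := ((d2 hf x).mul (d1 hg x)).sub ((d1 hf x).mul (d2 hg x))
    exact this.congr_deriv (by ring)
  have i1 : IntervalIntegrable (fun x => deriv (deriv f) x * g x) volume 0 1 :=
    (hf.continuous_deriv_deriv.mul hg.contDiff.continuous).intervalIntegrable _ _
  have i2 : IntervalIntegrable (fun x => f x * deriv (deriv g) x) volume 0 1 :=
    (hf.contDiff.continuous.mul hg.continuous_deriv_deriv).intervalIntegrable _ _
  have := intervalIntegral.integral_eq_sub_of_hasDerivAt (fun x _ => key x) (i1.sub i2)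
  rw [intervalIntegral.integral_sub i1 i2] at this
  simp only [hf.left, hf.right, hg.left, hg.right, mul_zero, zero_mul, sub_zero] at this
  linarith

theorem integral_cos_int_mul_pi (k : ℤ) (hk : k ≠ 0) :
    ∫ x in (0 : ℝ)..1, Real.cos (k * Real.pi * x) = 0 := by
  have hk' : (k : ℝ) * Real.pi ≠ 0 := mul_ne_zero (by exact_mod_cast hk) Real.pi_ne_zero
  rw [intervalIntegral.integral_comp_mul_left (fun x => Real.cos x) hk']
  simp [Real.sin_int_mul_pi]

theorem orthonormal_cosMode : Orthonormal ℝ fun n => toState (cosMode n) := by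
  rw [orthonormal_iff_ite]
  intro i j
  rw [inner_toState_toState, integral_rodMeasure]
  have hprod : ∀ x, cosMode j x * cosMode i x =
      ((if j = 0 then 1 else √2) * (if i = 0 then 1 else √2) / 2) *
      (Real.cos (((j - i : ℤ) : ℝ) * Real.pi * x) + Real.cos (((j + i : ℤ) : ℝ) * Real.pi * x)) := by
    intro x
    have e1 : ((j - i : ℤ) : ℝ) * Real.pi * x = j * Real.pi * x - i * Real.pi * x := by
      push_cast; ring
    have e2 : ((j + i : ℤ) : ℝ) * Real.pi * x = j * Real.pi * x + i * Real.pi * x := by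
      push_cast; ring
    rw [e1, e2, Real.cos_sub, Real.cos_add, cosMode_apply, cosMode_apply]
    ring
  simp only [hprod]
  rw [intervalIntegral.integral_const_mul, intervalIntegral.integral_add
    (Continuous.intervalIntegrable (by fun_prop) _ _)
    (Continuous.intervalIntegrable (by fun_prop) _ _)]
  by_cases hij : i = j
  · subst hij
    by_cases hi : i = 0
    · subst hi; norm_num
    · rw [integral_cos_int_mul_pi (i + i : ℤ) (by omega)]
      simp [hi]
  · rw [integral_cos_int_mul_pi (j + i : ℤ) (by omega),
      integral_cos_int_mul_pi (j - i : ℤ) (by omega)]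
    simp [hij]

/-- The space of cosine polynomials is closed under multiplication by `cos(πx)`; by Weierstrass'
theorem it is therefore dense. -/
theorem eval_cos_mem_span (p : Polynomial ℝ) :
    (⟨fun x => p.eval (Real.cos (Real.pi * x)), by fun_prop⟩ : C(ℝ, ℝ)) ∈
      Submodule.span ℝ (range cosMode) := by
  set S := Submodule.span ℝ (range cosMode)
  have hcos : ∀ n : ℕ, (⟨fun x => Real.cos (n * Real.pi * x), by fun_prop⟩ : C(ℝ, ℝ)) ∈ S := by
    intro n
    have : (⟨fun x => Real.cos (n * Real.pi * x), by fun_prop⟩ : C(ℝ, ℝ)) =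
        (if n = 0 then 1 else √2 : ℝ)⁻¹ • cosMode n := by
      ext x
      have h0 : (if n = 0 then 1 else √2 : ℝ) ≠ 0 := by split_ifs <;> positivity
      simp only [ContinuousMap.coe_mk, ContinuousMap.coe_smul, Pi.smul_apply, smul_eq_mul,
        cosMode_apply]
      rw [inv_mul_cancel_left₀ h0]
    rw [this]
    exact S.smul_mem _ (Submodule.subset_span ⟨n, rfl⟩)
  have hmul : ∀ f ∈ S, (⟨fun x => Real.cos (Real.pi * x), by fun_prop⟩ : C(ℝ, ℝ)) * f ∈ S := by
    intro f hf
    induction hf using Submodule.span_induction with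
    | mem f hf =>
      obtain ⟨n, rfl⟩ := hf
      have : (⟨fun x => Real.cos (Real.pi * x), by fun_prop⟩ : C(ℝ, ℝ)) * cosMode n =
          ((if n = 0 then 1 else √2 : ℝ) / 2) •
          ((⟨fun x => Real.cos ((n + 1 : ℕ) * Real.pi * x), by fun_prop⟩ : C(ℝ, ℝ)) +
           (⟨fun x => Real.cos (((n : ℤ) - 1).natAbs * Real.pi * x), by fun_prop⟩ : C(ℝ, ℝ))) := by
        ext x
        simp only [ContinuousMap.coe_mk, ContinuousMap.coe_smul, Pi.smul_apply, smul_eq_mul,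
          cosMode_apply, ContinuousMap.coe_mul, Pi.mul_apply, ContinuousMap.coe_add, Pi.add_apply]
        have e1 : ((n + 1 : ℕ) : ℝ) * Real.pi * x = n * Real.pi * x + Real.pi * x := by
          push_cast; ring
        have e2 : Real.cos ((((n : ℤ) - 1).natAbs : ℝ) * Real.pi * x) =
            Real.cos (n * Real.pi * x - Real.pi * x) := by
          rcases Nat.eq_zero_or_pos n with rfl | hn
          · simp
          · have : (((n : ℤ) - 1).natAbs : ℝ) = n - 1 := by
              have : ((n : ℤ) - 1).natAbs = n - 1 := by omega
              rw [this, Nat.cast_sub hn]; simp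
            rw [this]; congr 1; ring
        rw [e1, e2, Real.cos_add, Real.cos_sub]
        ring
      rw [this]
      exact S.smul_mem _ (S.add_mem (hcos _) (hcos _))
    | zero => rw [mul_zero]; exact S.zero_mem
    | add f g _ _ hf hg => rw [mul_add]; exact S.add_mem hf hg
    | smul c f _ hf => rw [mul_smul_comm]; exact S.smul_mem _ hf
  induction p using Polynomial.induction_on' with
  | add p q hp hq =>
    convert S.add_mem hp hq using 1
    ext x
    simp
  | monomial n a =>
    have hpow : (⟨fun x => Real.cos (Real.pi * x), by fun_prop⟩ : C(ℝ, ℝ)) ^ n ∈ S := by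
      induction n with
      | zero =>
        convert hcos 0 using 1
        ext x
        simp
      | succ n ih => rw [pow_succ']; exact hmul _ ih
    convert S.smul_mem a hpow using 1
    ext x
    simp

theorem dense_span_cosMode :
    ⊤ ≤ (Submodule.span ℝ (range fun n => toState (cosMode n))).topologicalClosure := by
  set S := Submodule.span ℝ (range fun n => toState (cosMode n)) with hS
  have hmap : ∀ f ∈ Submodule.span ℝ (range cosMode), toState f ∈ S := by
    intro f hf
    have := Submodule.mem_map_of_mem (f := toState) hf
    rwa [Submodule.map_span, ← range_comp] at this
  have hcont : ∀ g : BoundedContinuousFunction ℝ ℝ,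
      BoundedContinuousFunction.toLp 2 rodMeasure ℝ g ∈ closure (S : Set RodState) := by
    intro g
    rw [Metric.mem_closure_iff]
    intro ε hε
    obtain ⟨p, hp⟩ := exists_polynomial_near_of_continuousOn (-1) 1
      (fun y => g (Real.arccos y / Real.pi)) (by fun_prop) (ε / 2) (half_pos hε)
    refine ⟨_, hmap _ (eval_cos_mem_span p), ?_⟩
    have heq : BoundedContinuousFunction.toLp 2 rodMeasure ℝ g = toState g.toContinuousMap := by
      refine Lp.ext ?_
      exact (BoundedContinuousFunction.coeFn_toLp 2 rodMeasure ℝ g).trans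
        (coeFn_toState g.toContinuousMap).symm
    rw [heq, dist_eq_norm, ← map_sub]
    refine lt_of_le_of_lt (norm_toState_le _ (half_pos hε).le fun x hx => ?_) (half_lt_self hε)
    have h1 := hp (Real.cos (Real.pi * x)) ⟨Real.neg_one_le_cos _, Real.cos_le_one _⟩
    have h2 : Real.arccos (Real.cos (Real.pi * x)) / Real.pi = x := by
      rw [Real.arccos_cos (mul_nonneg Real.pi_pos.le hx.1)
        (by nlinarith [Real.pi_pos, hx.2]), mul_div_cancel_left₀ _ Real.pi_ne_zero]
    rw [h2, abs_sub_comm] at h1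
    exact h1.le
  intro f _
  have hd := BoundedContinuousFunction.toLp_denseRange (p := 2) ℝ rodMeasure ℝ (by norm_num)
  have := closure_minimal (s := range (BoundedContinuousFunction.toLp 2 rodMeasure ℝ))
    (t := closure (S : Set RodState)) (by rintro _ ⟨g, rfl⟩; exact hcont g) isClosed_closure
  exact this (hd f)

/-- The cosine basis of `L²(0,1)`. -/
noncomputable def cosBasis : HilbertBasis ℕ ℝ RodState :=
  HilbertBasis.mk orthonormal_cosMode dense_span_cosMode

theorem cosBasis_apply (n : ℕ) : cosBasis n = toState (cosMode n) := by
  simp [cosBasis]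

theorem inner_cosBasis (n : ℕ) (f : RodState) :
    inner ℝ (cosBasis n) f = ∫ x, f x * cosMode n x ∂rodMeasure := by
  rw [cosBasis_apply, inner_toState]

/-- A continuous function whose cosine coefficients are absolutely summable is the sum of its
cosine series at every point of `[0,1]`. -/
theorem hasSum_cosine_series (f : C(ℝ, ℝ))
    (hf : Summable fun n => |inner ℝ (cosBasis n) (toState f)|) {x : ℝ} (hx : x ∈ Icc (0 : ℝ) 1) :
    HasSum (fun n => inner ℝ (cosBasis n) (toState f) * cosMode n x) (f x) := by
  set c : ℕ → ℝ := fun n => inner ℝ (cosBasis n) (toState f)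
  have hb : ∀ n x, ‖c n * cosMode n x‖ ≤ |c n| * 2 := fun n x => by
    rw [norm_mul]
    exact mul_le_mul_of_nonneg_left (abs_cosMode_le n x) (abs_nonneg _)
  have hsum : ∀ x, Summable fun n => c n * cosMode n x := fun x =>
    Summable.of_norm_bounded (hf.mul_right 2) fun n => hb n x
  let g : C(ℝ, ℝ) := ⟨fun x => ∑' n, c n * cosMode n x,
    continuous_tsum (fun n => by fun_prop) (hf.mul_right 2) hb⟩
  have hg : toState g = toState f := by
    have h1 : HasSum (fun n => c n • cosBasis n) (toState f) := by
      simpa only [cosBasis.repr_apply_apply] using cosBasis.hasSum_repr (toState f)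
    refine tendsto_nhds_unique ?_ h1.tendsto_sum_nat
    rw [tendsto_iff_norm_sub_tendsto_zero]
    refine squeeze_zero (fun _ => norm_nonneg _) (fun N => ?_)
      (tendsto_sum_nat_add fun n => |c n| * 2)
    have : ∑ n ∈ Finset.range N, c n • cosBasis n - toState g
        = toState (∑ n ∈ Finset.range N, c n • cosMode n - g) := by
      simp [cosBasis_apply]
    rw [this]
    refine norm_toState_le _ (tsum_nonneg fun n => by positivity) fun x _ => ?_
    have h2 := (hsum x).sum_add_tsum_nat_add N
    have h3 : (∑ n ∈ Finset.range N, c n • cosMode n - g) x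
        = -∑' n, c (n + N) * cosMode (n + N) x := by
      simp only [ContinuousMap.coe_sub, Pi.sub_apply, ContinuousMap.coe_sum, Finset.sum_apply,
        ContinuousMap.coe_smul, Pi.smul_apply, smul_eq_mul]
      change _ - ∑' n, c n * cosMode n x = _
      linarith
    rw [h3, abs_neg]
    exact tsum_of_norm_bounded ((summable_nat_add_iff N).2 (hf.mul_right 2)).hasSum
      fun n => hb (n + N) x
  have := eqOn_of_toState_eq hg hx
  rw [← this]
  exact (hsum x).hasSum

theorem summable_inv_eigenvalue : Summable fun n => (eigenvalue n)⁻¹ := by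
  have := (Real.summable_nat_pow_inv (p := 2)).2 (by norm_num)
  refine (this.mul_left (Real.pi ^ 2)⁻¹).congr fun n => ?_
  rw [eigenvalue, mul_pow, mul_inv, mul_comm]

theorem eigenvalue_nonneg (n : ℕ) : 0 ≤ eigenvalue n := sq_nonneg _

theorem eigenvalue_pos {n : ℕ} (hn : n ≠ 0) : 0 < eigenvalue n := by
  have := Real.pi_pos
  rw [eigenvalue]
  positivity

/-- The cosine coefficients of a Neumann test function and of its second derivative. -/
theorem IsNeumannTest.inner_cosBasis_deriv {ψ : ℝ → ℝ} (hψ : IsNeumannTest ψ) (n : ℕ) :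
    inner ℝ (cosBasis n) (toState ⟨deriv (deriv ψ), hψ.continuous_deriv_deriv⟩) =
      -eigenvalue n * inner ℝ (cosBasis n) (toState ⟨ψ, hψ.contDiff.continuous⟩) := by
  rw [cosBasis_apply, inner_toState_toState, inner_toState_toState, integral_rodMeasure,
    integral_rodMeasure]
  simp only [ContinuousMap.coe_mk]
  rw [hψ.integral_deriv_deriv_mul (isNeumannTest_cosMode n), ← intervalIntegral.integral_const_mul]
  refine intervalIntegral.integral_congr fun x _ => ?_
  simp only [deriv_deriv_cosMode]
  ring

/-! ### Coordinates in a Hilbert basis -/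

section HilbertBasis

variable {H : Type*} [NormedAddCommGroup H] [InnerProductSpace ℝ H] (e : HilbertBasis ℕ ℝ H)

theorem hasSum_inner_sq (x : H) : HasSum (fun n => inner ℝ (e n) x ^ 2) (‖x‖ ^ 2) := by
  rw [← real_inner_self_eq_norm_sq]
  refine (e.hasSum_inner_mul_inner x x).congr_fun fun n => ?_
  rw [real_inner_comm, sq]

theorem hilbertBasis_ext {x y : H} (h : ∀ n, inner ℝ (e n) x = inner ℝ (e n) y) : x = y := by
  apply e.repr.injective
  ext n
  simpa only [e.repr_apply_apply] using h n

theorem exists_inner_eq {c : ℕ → ℝ} (hc : Summable fun n => c n ^ 2) :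
    ∃ x : H, ∀ n, inner ℝ (e n) x = c n := by
  have hm : Memℓp c 2 := by
    rw [memℓp_gen_iff (by norm_num)]
    simpa using hc
  refine ⟨e.repr.symm ⟨c, hm⟩, fun n => ?_⟩
  rw [← e.repr_apply_apply, LinearIsometryEquiv.apply_symm_apply]

/-- Dominated convergence of the coordinates implies convergence in norm. -/
theorem tendsto_of_tendsto_inner {α : Type*} {l : Filter α} {w : α → H} {x : H} {d : ℕ → ℝ}
    (hd : Summable d) (h : ∀ n, Tendsto (fun a => inner ℝ (e n) (w a)) l (𝓝 (inner ℝ (e n) x)))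
    (hb : ∀ᶠ a in l, ∀ n, (inner ℝ (e n) (w a) - inner ℝ (e n) x) ^ 2 ≤ d n) :
    Tendsto w l (𝓝 x) := by
  have h1 : Tendsto (fun a => ‖w a - x‖ ^ 2) l (𝓝 0) := by
    have h2 := tendsto_tsum_of_dominated_convergence (𝓕 := l) hd
      (f := fun a n => (inner ℝ (e n) (w a) - inner ℝ (e n) x) ^ 2) (g := fun _ => 0)
      (fun n => by simpa using ((h n).sub_const (inner ℝ (e n) x)).pow 2)
      (hb.mono fun a ha n => by rw [Real.norm_of_nonneg (sq_nonneg _)]; exact ha n)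
    rw [tsum_zero] at h2
    refine h2.congr fun a => ?_
    rw [← (hasSum_inner_sq e (w a - x)).tsum_eq]
    simp only [inner_sub_right]
  rw [tendsto_iff_norm_sub_tendsto_zero]
  have := h1.sqrt
  simpa only [Real.sqrt_sq (norm_nonneg _), Real.sqrt_zero] using this

theorem exists_boundedContinuous_inner_eq {c : ℕ → ℝ → ℝ} (hcc : ∀ n, Continuous (c n))
    {d : ℕ → ℝ} (hd : Summable d) (hcd : ∀ n t, c n t ^ 2 ≤ d n) :
    ∃ Y : BoundedContinuousFunction ℝ H, ∀ n t, inner ℝ (e n) (Y t) = c n t := by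
  have hs : ∀ t, Summable fun n => c n t ^ 2 := fun t =>
    Summable.of_nonneg_of_le (fun n => sq_nonneg (c n t)) (fun n => hcd n t) hd
  choose Y hY using fun t => exists_inner_eq e (hs t)
  have hYc : Continuous Y := by
    refine continuous_iff_continuousAt.2 fun t => ?_
    refine tendsto_of_tendsto_inner e (hd.mul_left 4) (fun n => ?_)
      (Eventually.of_forall fun s n => ?_)
    · simp only [hY]
      exact (hcc n).continuousAt
    · simp only [hY]
      nlinarith [hcd n t, hcd n s, sq_nonneg (c n t + c n s)]
  refine ⟨BoundedContinuousFunction.ofNormedAddCommGroup Y hYc (√(∑' n, d n)) fun t => ?_,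
    fun n t => hY t n⟩
  refine Real.le_sqrt_of_sq_le ?_
  rw [← (hasSum_inner_sq e (Y t)).tsum_eq]
  exact (hasSum_inner_sq e (Y t)).summable.tsum_le_tsum (fun n => by rw [hY]; exact hcd n t) hd

end HilbertBasis

/-! ### Solutions of the modal equations by a fixed point argument -/

/-- Duhamel's formula for the solution of `c' = -a c + h`, `c 0 = c₀`. -/
noncomputable def duhamel (a c₀ : ℝ) (h : ℝ → ℝ) (t : ℝ) : ℝ :=
  Real.exp (-a * t) * (c₀ + ∫ s in (0 : ℝ)..t, Real.exp (a * s) * h s)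

theorem duhamel_zero (a c₀ : ℝ) (h : ℝ → ℝ) : duhamel a c₀ h 0 = c₀ := by simp [duhamel]

theorem hasDerivAt_duhamel (a c₀ : ℝ) {h : ℝ → ℝ} (hh : Continuous h) (t : ℝ) :
    HasDerivAt (duhamel a c₀ h) (-a * duhamel a c₀ h t + h t) t := by
  have h1 : HasDerivAt (fun t => Real.exp (-a * t)) (Real.exp (-a * t) * -a) t := by
    simpa using ((hasDerivAt_id t).const_mul (-a)).exp
  have hc : Continuous fun s => Real.exp (a * s) * h s := by fun_prop
  have h2 := (hc.integral_hasStrictDerivAt 0 t).hasDerivAt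
  refine (h1.mul (h2.const_add c₀)).congr_deriv ?_
  have : Real.exp (-a * t) * (Real.exp (a * t) * h t) = h t := by
    rw [← mul_assoc, ← Real.exp_add]; simp
  rw [this, duhamel]
  ring

theorem abs_duhamel_le {a : ℝ} (ha : 0 < a) (c₀ : ℝ) {h : ℝ → ℝ} {D : ℝ}
    (hD : ∀ s, |h s| ≤ D) {t : ℝ} (ht : 0 ≤ t) : |duhamel a c₀ h t| ≤ |c₀| + D / a := by
  have hD0 : 0 ≤ D := (abs_nonneg _).trans (hD 0)
  have hint : ∫ s in (0 : ℝ)..t, Real.exp (a * s) * D = (Real.exp (a * t) - 1) / a * D := by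
    rw [intervalIntegral.integral_mul_const, intervalIntegral.integral_comp_mul_left
      (fun x => Real.exp x) ha.ne', integral_exp]
    simp only [mul_zero, Real.exp_zero, smul_eq_mul]
    ring
  have h1 : |∫ s in (0 : ℝ)..t, Real.exp (a * s) * h s| ≤ (Real.exp (a * t) - 1) / a * D := by
    rw [← hint, ← Real.norm_eq_abs]
    refine intervalIntegral.norm_integral_le_of_norm_le ht ?_
      (Continuous.intervalIntegrable (by fun_prop) _ _)
    refine Eventually.of_forall fun s _ => ?_
    rw [norm_mul, Real.norm_of_nonneg (Real.exp_pos _).le]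
    exact mul_le_mul_of_nonneg_left (hD s) (Real.exp_pos _).le
  have h2 : Real.exp (-a * t) ≤ 1 := Real.exp_le_one_iff.2 (by nlinarith)
  have h3 : Real.exp (-a * t) * Real.exp (a * t) = 1 := by rw [← Real.exp_add]; simp
  rw [duhamel, abs_mul, abs_of_pos (Real.exp_pos _)]
  calc Real.exp (-a * t) * |c₀ + ∫ s in (0 : ℝ)..t, Real.exp (a * s) * h s|
      ≤ Real.exp (-a * t) * (|c₀| + (Real.exp (a * t) - 1) / a * D) :=
        mul_le_mul_of_nonneg_left ((abs_add_le _ _).trans (add_le_add_right h1 _))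
          (Real.exp_pos _).le
    _ = Real.exp (-a * t) * |c₀| + (Real.exp (-a * t) * Real.exp (a * t) - Real.exp (-a * t))
          * (D / a) := by ring
    _ ≤ 1 * |c₀| + 1 * (D / a) := by
        rw [h3]
        exact add_le_add (mul_le_mul_of_nonneg_right h2 (abs_nonneg _))
          (mul_le_mul_of_nonneg_right (by linarith [Real.exp_pos (-a * t)]) (by positivity))
    _ = _ := by ring

theorem duhamel_sub_duhamel (a c₀ : ℝ) {h h' : ℝ → ℝ} (hh : Continuous h) (hh' : Continuous h')
    (t : ℝ) : duhamel a c₀ h t - duhamel a c₀ h' t = duhamel a 0 (fun s => h s - h' s) t := by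
  simp only [duhamel, mul_sub, zero_add]
  rw [intervalIntegral.integral_sub (Continuous.intervalIntegrable (by fun_prop) _ _)
    (Continuous.intervalIntegrable (by fun_prop) _ _)]
  ring

/-- The system of modal equations `c_n' = -λ_n c_n + ℓ_n(w)`, `c_n` being the coordinates of `w`,
has a continuous solution for every initial value. The bound on `ℓ_n` is only uniform in `n`: the
square summability of `(λ_n + μ)⁻¹` makes up for the unboundedness of the control operator. The
weight `exp(-μt)` makes the fixed point equation a contraction on all of `[0,∞)`. -/
theorem exists_modal_solution {H : Type*} [NormedAddCommGroup H] [InnerProductSpace ℝ H]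
    [CompleteSpace H] (e : HilbertBasis ℕ ℝ H) {lam : ℕ → ℝ} (hlam : ∀ n, 0 ≤ lam n)
    (hsum : Summable fun n => (lam n + 1)⁻¹) (ℓ : ℕ → H →L[ℝ] ℝ) {C : ℝ}
    (hC0 : 0 ≤ C) (hC : ∀ n x, |ℓ n x| ≤ C * ‖x‖) (z₀ : H) :
    ∃ w : ℝ → H, Continuous w ∧ w 0 = z₀ ∧ ∀ n, ∀ t, 0 ≤ t →
      inner ℝ (e n) (w t) = inner ℝ (e n) z₀ +
        ∫ s in (0 : ℝ)..t, (-lam n * inner ℝ (e n) (w s) + ℓ n (w s)) := by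
  set S := ∑' n, (lam n + 1)⁻¹ with hS
  have hS0 : 0 ≤ S := tsum_nonneg fun n => inv_nonneg.2 (by linarith [hlam n])
  set μ := 1 + 4 * C ^ 2 * S
  have hμ1 : 1 ≤ μ := by have : 0 ≤ 4 * C ^ 2 * S := by positivity
                         linarith
  have hμ0 : 0 < μ := by linarith
  have ha : ∀ n, 0 < lam n + μ := fun n => by linarith [hlam n]
  have hinv : ∀ n, ((lam n + μ)⁻¹) ^ 2 ≤ μ⁻¹ * (lam n + 1)⁻¹ := fun n => by
    rw [inv_pow, ← mul_inv]
    have := hlam n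
    exact inv_anti₀ (mul_pos hμ0 (by linarith)) (by nlinarith)
  have hsum2 : Summable fun n => ((lam n + μ)⁻¹) ^ 2 :=
    Summable.of_nonneg_of_le (fun n => sq_nonneg _) hinv (hsum.mul_left _)
  have htsum2 : ∑' n, ((lam n + μ)⁻¹) ^ 2 ≤ μ⁻¹ * S := by
    rw [hS, ← tsum_mul_left]
    exact hsum2.tsum_le_tsum hinv (hsum.mul_left _)
  have hcont : ∀ (y : BoundedContinuousFunction ℝ H) n, Continuous fun s => ℓ n (y s) :=
    fun y n => (ℓ n).continuous.comp y.continuous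
  -- the right hand side of the fixed point equation
  have hstep : ∀ y : BoundedContinuousFunction ℝ H, ∃ Y : BoundedContinuousFunction ℝ H, ∀ t n,
      inner ℝ (e n) (Y t) =
        duhamel (lam n + μ) (inner ℝ (e n) z₀) (fun s => ℓ n (y s)) (max t 0) := by
    intro y
    set c : ℕ → ℝ → ℝ := fun n t =>
      duhamel (lam n + μ) (inner ℝ (e n) z₀) (fun s => ℓ n (y s)) (max t 0)
    have hcc : ∀ n, Continuous (c n) := fun n => by
      have : Continuous (duhamel (lam n + μ) (inner ℝ (e n) z₀) (fun s => ℓ n (y s))) :=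
        continuous_iff_continuousAt.2 fun t =>
          (hasDerivAt_duhamel _ _ (hcont y n) t).continuousAt
      exact this.comp (continuous_id.max continuous_const)
    set d : ℕ → ℝ := fun n => 2 * inner ℝ (e n) z₀ ^ 2 + 2 * ((C * ‖y‖) * (lam n + μ)⁻¹) ^ 2
    have hd2 : Summable fun n => 2 * ((C * ‖y‖) * (lam n + μ)⁻¹) ^ 2 :=
      ((hsum2.mul_left ((C * ‖y‖) ^ 2)).mul_left 2).congr fun n => by rw [mul_pow (C * ‖y‖)]
    have hd : Summable d := ((hasSum_inner_sq e z₀).summable.mul_left 2).add hd2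
    have hD : ∀ n s, |ℓ n (y s)| ≤ C * ‖y‖ := fun n s =>
      (hC n _).trans (mul_le_mul_of_nonneg_left (y.norm_coe_le_norm s) hC0)
    have hcd : ∀ n t, c n t ^ 2 ≤ d n := fun n t => by
      have h1 := abs_duhamel_le (ha n) (inner ℝ (e n) z₀) (hD n) (le_max_right t 0)
      have h2 : c n t ^ 2 ≤ (|inner ℝ (e n) z₀| + C * ‖y‖ / (lam n + μ)) ^ 2 := by
        rw [← sq_abs (c n t)]
        exact pow_le_pow_left₀ (abs_nonneg _) h1 2
      refine h2.trans ?_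
      rw [div_eq_mul_inv]
      have := add_sq_le (a := |inner ℝ (e n) z₀|) (b := C * ‖y‖ * (lam n + μ)⁻¹)
      rw [sq_abs, mul_add] at this
      exact this
    obtain ⟨Y, hY⟩ := exists_boundedContinuous_inner_eq e hcc hd hcd
    exact ⟨Y, fun t n => hY n t⟩
  choose Φ hΦ using hstep
  have hcontr : ContractingWith (1 / 2) Φ := by
    refine ⟨by rw [← NNReal.coe_lt_coe]; norm_num, LipschitzWith.of_dist_le_mul fun y y' => ?_⟩
    rw [dist_eq_norm (Φ y), BoundedContinuousFunction.norm_le (by positivity)]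
    intro t
    refine le_of_sq_le_sq ?_ (by positivity)
    have hb : ∀ n, inner ℝ (e n) ((Φ y - Φ y') t) ^ 2 ≤
        (C * dist y y') ^ 2 * ((lam n + μ)⁻¹) ^ 2 := fun n => by
      rw [BoundedContinuousFunction.coe_sub, Pi.sub_apply, inner_sub_right, hΦ, hΦ,
        duhamel_sub_duhamel _ _ (hcont y n)
          (hcont y' n)]
      have hD : ∀ s, |ℓ n (y s) - ℓ n (y' s)| ≤ C * dist y y' := fun s => by
        rw [← map_sub]
        refine (hC n _).trans (mul_le_mul_of_nonneg_left ?_ hC0)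
        rw [← dist_eq_norm]
        exact BoundedContinuousFunction.dist_coe_le_dist s
      have h1 := abs_duhamel_le (ha n) 0 hD (le_max_right t 0)
      rw [abs_zero, zero_add] at h1
      calc _ = |duhamel (lam n + μ) 0 (fun s => ℓ n (y s) - ℓ n (y' s)) (max t 0)| ^ 2 :=
            (sq_abs _).symm
        _ ≤ (C * dist y y' / (lam n + μ)) ^ 2 := pow_le_pow_left₀ (abs_nonneg _) h1 2
        _ = _ := by rw [div_eq_mul_inv, mul_pow]
    rw [← (hasSum_inner_sq e ((Φ y - Φ y') t)).tsum_eq]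
    have hCS : C ^ 2 * (μ⁻¹ * S) ≤ 1 / 4 := by
      have : C ^ 2 * (μ⁻¹ * S) = (C ^ 2 * S) / μ := by field_simp
      rw [this, div_le_iff₀ hμ0]
      linarith
    calc _ ≤ ∑' n, (C * dist y y') ^ 2 * ((lam n + μ)⁻¹) ^ 2 :=
          (hasSum_inner_sq e _).summable.tsum_le_tsum hb (hsum2.mul_left _)
      _ = (C * dist y y') ^ 2 * ∑' n, ((lam n + μ)⁻¹) ^ 2 := tsum_mul_left
      _ ≤ (C * dist y y') ^ 2 * (μ⁻¹ * S) := mul_le_mul_of_nonneg_left htsum2 (sq_nonneg _)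
      _ = C ^ 2 * (μ⁻¹ * S) * dist y y' ^ 2 := by ring
      _ ≤ 1 / 4 * dist y y' ^ 2 := mul_le_mul_of_nonneg_right hCS (sq_nonneg _)
      _ = _ := by push_cast; ring
  set y := ContractingWith.fixedPoint Φ hcontr
  have hy : Φ y = y := hcontr.fixedPoint_isFixedPt
  have hyn : ∀ n t, 0 ≤ t → inner ℝ (e n) (y t) =
      duhamel (lam n + μ) (inner ℝ (e n) z₀) (fun s => ℓ n (y s)) t := fun n t ht => by
    conv_lhs => rw [← hy]
    rw [hΦ, max_eq_left ht]
  refine ⟨fun t => Real.exp (μ * t) • y t, by fun_prop, ?_, fun n t ht => ?_⟩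
  · refine hilbertBasis_ext e fun n => ?_
    simp [hyn n 0 le_rfl, duhamel_zero]
  · have hderiv : ∀ s, HasDerivAt (fun s => Real.exp (μ * s) *
        duhamel (lam n + μ) (inner ℝ (e n) z₀) (fun s => ℓ n (y s)) s)
        (-lam n * (Real.exp (μ * s) *
          duhamel (lam n + μ) (inner ℝ (e n) z₀) (fun s => ℓ n (y s)) s) +
          ℓ n (Real.exp (μ * s) • y s)) s := fun s => by
      have h1 : HasDerivAt (fun s => Real.exp (μ * s)) (Real.exp (μ * s) * μ) s := by
        simpa using ((hasDerivAt_id s).const_mul μ).exp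
      refine (h1.mul (hasDerivAt_duhamel (lam n + μ) (inner ℝ (e n) z₀)
        (hcont y n) s)).congr_deriv ?_
      rw [map_smul, smul_eq_mul]
      ring
    have hcd : Continuous (duhamel (lam n + μ) (inner ℝ (e n) z₀) (fun s => ℓ n (y s))) :=
      continuous_iff_continuousAt.2 fun t =>
        (hasDerivAt_duhamel _ _ (hcont y n) t).continuousAt
    have := intervalIntegral.integral_eq_sub_of_hasDerivAt (a := 0) (b := t) (fun s _ => hderiv s)
      (Continuous.intervalIntegrable (by fun_prop) _ _)
    rw [duhamel_zero, mul_zero, Real.exp_zero, one_mul] at this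
    rw [inner_smul_right, hyn n t ht, ← sub_eq_iff_eq_add', ← this]
    refine intervalIntegral.integral_congr fun s hs => ?_
    rw [uIcc_of_le ht] at hs
    simp only [inner_smul_right, hyn n s hs.1]

/-! ### Calculus for primitives of integrable functions -/

theorem intervalIntegrable_finsetSum {ι : Type*} (S : Finset ι) {f : ι → ℝ → ℝ} {a b : ℝ}
    (h : ∀ i ∈ S, IntervalIntegrable (f i) volume a b) :
    IntervalIntegrable (fun s => ∑ i ∈ S, f i s) volume a b := by
  have := IntervalIntegrable.sum S h
  rwa [Finset.sum_fn] at this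

/-- The product rule for two primitives of integrable functions. -/
theorem mul_eq_add_integral {f g p q : ℝ → ℝ} {T : ℝ} (hT : 0 ≤ T)
    (hp : IntervalIntegrable p volume 0 T) (hq : IntervalIntegrable q volume 0 T)
    (hf : ∀ t ∈ Icc 0 T, f t = f 0 + ∫ s in (0 : ℝ)..t, p s)
    (hg : ∀ t ∈ Icc 0 T, g t = g 0 + ∫ s in (0 : ℝ)..t, q s) :
    f T * g T = f 0 * g 0 + ∫ s in (0 : ℝ)..T, (p s * g s + f s * q s) := by
  have h0 : (0 : ℝ) ∈ uIcc 0 T := left_mem_uIcc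
  have ac : ∀ {p : ℝ → ℝ} (c : ℝ), IntervalIntegrable p volume 0 T →
      AbsolutelyContinuousOnInterval (fun t => c + ∫ s in (0 : ℝ)..t, p s) 0 T := by
    intro p c hp
    have h1 : AbsolutelyContinuousOnInterval (fun _ : ℝ => c) 0 T :=
      (LipschitzWith.const c).lipschitzOnWith.absolutelyContinuousOnInterval
    exact h1.fun_add (hp.absolutelyContinuousOnInterval_intervalIntegral h0)
  have key := (ac (f 0) hp).integral_deriv_mul_eq_sub (ac (g 0) hq)
  simp only [intervalIntegral.integral_same, add_zero] at key
  rw [← hf T (right_mem_Icc.2 hT), ← hg T (right_mem_Icc.2 hT)] at key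
  rw [← sub_eq_iff_eq_add', ← key]
  refine intervalIntegral.integral_congr_ae ?_
  filter_upwards [hp.ae_hasDerivAt_integral, hq.ae_hasDerivAt_integral] with x hx hx' hxm
  have hxu : x ∈ uIcc 0 T := uIoc_subset_uIcc hxm
  have hxi : x ∈ Icc 0 T := by rwa [uIcc_of_le hT] at hxu
  rw [((hx hxu 0 h0).const_add (f 0)).deriv, ((hx' hxu 0 h0).const_add (g 0)).deriv,
    ← hf x hxi, ← hg x hxi]

/-- An integrable function with integrable derivative on `(0,∞)` tends to zero. -/
theorem tendsto_zero_of_integrableOn {f p : ℝ → ℝ} (hf : IntegrableOn f (Ioi 0))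
    (hp : IntegrableOn p (Ioi 0)) (h : ∀ t, 0 ≤ t → f t = f 0 + ∫ s in (0 : ℝ)..t, p s) :
    Tendsto f atTop (𝓝 0) := by
  have h1 : Tendsto f atTop (𝓝 (f 0 + ∫ s in Ioi (0 : ℝ), p s)) := by
    refine ((intervalIntegral_tendsto_integral_Ioi 0 hp tendsto_id).const_add (f 0)).congr' ?_
    filter_upwards [eventually_ge_atTop (0 : ℝ)] with t ht
    exact (h t ht).symm
  have h2 : IntegrableAtFilter f atTop := ⟨Ioi 0, Ioi_mem_atTop 0, hf⟩
  have h3 := h2.eq_zero_of_tendsto (fun s hs => by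
    obtain ⟨b, hb⟩ := mem_atTop_sets.1 hs
    rw [← top_le_iff, ← Real.volume_Ici (a := b)]
    exact measure_mono hb) h1
  rwa [h3] at h1

/-! ### Modal trajectories -/

/-- The equations of a trajectory in the coordinates of a Hilbert basis of eigenvectors of the
generator, with eigenvalues `-λ_n`; `b n` is the `n`-th coordinate of the (unbounded) control
operator. -/
structure IsModalTrajectory {H ι : Type*} [NormedAddCommGroup H] [InnerProductSpace ℝ H]
    [Fintype ι] (e : HilbertBasis ℕ ℝ H) (lam : ℕ → ℝ) (b : ℕ → ι → ℝ) (u : ℝ → ι → ℝ)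
    (w : ℝ → H) : Prop where
  control_memLp : ∀ T : ℝ, MemLp u 2 (volume.restrict (Ioc 0 T))
  continuousOn : ContinuousOn w (Ici 0)
  modal : ∀ n, ∀ t, 0 ≤ t → inner ℝ (e n) (w t) = inner ℝ (e n) (w 0) +
    ∫ s in (0 : ℝ)..t, (-lam n * inner ℝ (e n) (w s) + b n ⬝ᵥ u s)

namespace IsModalTrajectory

variable {H ι : Type*} [NormedAddCommGroup H] [InnerProductSpace ℝ H] [Fintype ι]
  {e : HilbertBasis ℕ ℝ H} {lam : ℕ → ℝ} {b : ℕ → ι → ℝ} {u : ℝ → ι → ℝ} {w : ℝ → H}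

theorem memLp_control_apply (h : IsModalTrajectory e lam b u w) (k : ι) (T : ℝ) :
    MemLp (fun s => u s k) 2 (volume.restrict (Ioc 0 T)) :=
  (h.control_memLp T).eval k

theorem memLp_input (h : IsModalTrajectory e lam b u w) (c : ι → ℝ) (T : ℝ) :
    MemLp (fun s => c ⬝ᵥ u s) 2 (volume.restrict (Ioc 0 T)) := by
  simp only [dotProduct]
  exact memLp_finsetSum _ fun k _ => (h.memLp_control_apply k T).const_mul (c k)

theorem intervalIntegrable_control (h : IsModalTrajectory e lam b u w) (k : ι) {T : ℝ}
    (hT : 0 ≤ T) : IntervalIntegrable (fun s => u s k) volume 0 T := by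
  rw [intervalIntegrable_iff_integrableOn_Ioc_of_le hT]
  exact (h.memLp_control_apply k T).integrable (by norm_num)

theorem intervalIntegrable_input (h : IsModalTrajectory e lam b u w) (c : ι → ℝ) {T : ℝ}
    (hT : 0 ≤ T) : IntervalIntegrable (fun s => c ⬝ᵥ u s) volume 0 T := by
  rw [intervalIntegrable_iff_integrableOn_Ioc_of_le hT]
  exact (h.memLp_input c T).integrable (by norm_num)

theorem continuousOn_uIcc (h : IsModalTrajectory e lam b u w) {T : ℝ} (hT : 0 ≤ T) :
    ContinuousOn w (uIcc 0 T) := by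
  rw [uIcc_of_le hT]
  exact h.continuousOn.mono Icc_subset_Ici_self

theorem continuousOn_inner (h : IsModalTrajectory e lam b u w) (x : H) {T : ℝ} (hT : 0 ≤ T) :
    ContinuousOn (fun s => inner ℝ x (w s)) (uIcc 0 T) :=
  continuousOn_const.inner (h.continuousOn_uIcc hT)

theorem intervalIntegrable_modal (h : IsModalTrajectory e lam b u w) (n : ℕ) {T : ℝ}
    (hT : 0 ≤ T) :
    IntervalIntegrable (fun s => -lam n * inner ℝ (e n) (w s) + b n ⬝ᵥ u s) volume 0 T :=
  ((continuousOn_const.mul (h.continuousOn_inner (e n) hT)).intervalIntegrable).add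
    (h.intervalIntegrable_input (b n) hT)

theorem mul_modal (h : IsModalTrajectory e lam b u w) (i j : ℕ) {T : ℝ} (hT : 0 ≤ T) :
    inner ℝ (e i) (w T) * inner ℝ (e j) (w T) = inner ℝ (e i) (w 0) * inner ℝ (e j) (w 0) +
      ∫ s in (0 : ℝ)..T, ((-lam i * inner ℝ (e i) (w s) + b i ⬝ᵥ u s) * inner ℝ (e j) (w s) +
        inner ℝ (e i) (w s) * (-lam j * inner ℝ (e j) (w s) + b j ⬝ᵥ u s)) :=
  mul_eq_add_integral (f := fun s => inner ℝ (e i) (w s)) (g := fun s => inner ℝ (e j) (w s)) hT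
    (h.intervalIntegrable_modal i hT) (h.intervalIntegrable_modal j hT)
    (fun t ht => h.modal i t ht.1) (fun t ht => h.modal j t ht.1)

end IsModalTrajectory

/-! ### The energy identity -/

section Truncation

variable {H : Type*} [NormedAddCommGroup H] [InnerProductSpace ℝ H] (e : HilbertBasis ℕ ℝ H)

/-- The orthogonal projection onto the first `N` modes. -/
noncomputable def truncation (N : ℕ) (x : H) : H :=
  ∑ i ∈ Finset.range N, inner ℝ (e i) x • e i

theorem tendsto_truncation (x : H) : Tendsto (fun N => truncation e N x) atTop (𝓝 x) := by
  have := (e.hasSum_repr x).tendsto_sum_nat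
  simpa only [e.repr_apply_apply, truncation] using this

theorem norm_truncation_le (N : ℕ) (x : H) : ‖truncation e N x‖ ≤ ‖x‖ := by
  refine le_of_sq_le_sq ?_ (norm_nonneg _)
  have h1 : ‖truncation e N x‖ ^ 2 = ∑ i ∈ Finset.range N, inner ℝ (e i) x ^ 2 := by
    rw [← real_inner_self_eq_norm_sq, truncation, e.orthonormal.inner_sum]
    simp [sq]
  rw [h1]
  exact sum_le_hasSum _ (fun i _ => sq_nonneg _) (hasSum_inner_sq e x)

theorem inner_map_truncation (A : H →L[ℝ] H) (N : ℕ) (x : H) :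
    inner ℝ (A (truncation e N x)) (truncation e N x) =
      ∑ i ∈ Finset.range N, ∑ j ∈ Finset.range N,
        inner ℝ (A (e i)) (e j) * (inner ℝ (e i) x * inner ℝ (e j) x) := by
  rw [truncation, map_sum, sum_inner]
  refine Finset.sum_congr rfl fun i _ => ?_
  rw [inner_sum]
  refine Finset.sum_congr rfl fun j _ => ?_
  rw [map_smul, inner_smul_left, inner_smul_right]
  simp only [conj_trivial]
  ring

end Truncation

/-- Along a trajectory the derivative of `⟨P w, w⟩` is `-⟨D w, w⟩ + 2 ∑ u_k ⟨G_k, w⟩`, where `D` is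
given by the Lyapunov equation `Λ P + P Λ = D` and `G_k` is `P` applied to the (unbounded) `k`-th
column of the control operator. The identity is proved for the truncations to finitely many
modes. -/
theorem IsModalTrajectory.inner_map_eq {H ι : Type*} [NormedAddCommGroup H]
    [InnerProductSpace ℝ H] [Fintype ι]
    {e : HilbertBasis ℕ ℝ H} {lam : ℕ → ℝ} {b : ℕ → ι → ℝ} {u : ℝ → ι → ℝ} {w : ℝ → H}
    (h : IsModalTrajectory e lam b u w) (P D : H →L[ℝ] H) (G : ι → H)
    (hPs : ∀ x y, inner ℝ (P x) y = inner ℝ (P y) x)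
    (hPD : ∀ i j, (lam i + lam j) * inner ℝ (P (e i)) (e j) = inner ℝ (D (e i)) (e j))
    (hG : ∀ k, HasSum (fun i => b i k • P (e i)) (G k)) {t : ℝ} (ht : 0 ≤ t) :
    inner ℝ (P (w t)) (w t) = inner ℝ (P (w 0)) (w 0) +
      ∫ s in (0 : ℝ)..t, (-inner ℝ (D (w s)) (w s) + 2 * ∑ k, u s k * inner ℝ (G k) (w s)) := by
  -- the identity for the truncations
  have trunc : ∀ N, inner ℝ (P (truncation e N (w t))) (truncation e N (w t)) =
      inner ℝ (P (truncation e N (w 0))) (truncation e N (w 0)) +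
      ∫ s in (0 : ℝ)..t, (-inner ℝ (D (truncation e N (w s))) (truncation e N (w s)) +
        2 * ∑ k, u s k * inner ℝ (∑ i ∈ Finset.range N, b i k • P (e i))
          (truncation e N (w s))) := by
    intro N
    have hint : ∀ i j, IntervalIntegrable (fun s => inner ℝ (P (e i)) (e j) *
        ((-lam i * inner ℝ (e i) (w s) + b i ⬝ᵥ u s) * inner ℝ (e j) (w s) +
        inner ℝ (e i) (w s) * (-lam j * inner ℝ (e j) (w s) + b j ⬝ᵥ u s))) volume 0 t :=
      fun i j => (((h.intervalIntegrable_modal i ht).mul_continuousOn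
        (h.continuousOn_inner (e j) ht)).add ((h.intervalIntegrable_modal j ht).continuousOn_mul
        (h.continuousOn_inner (e i) ht))).const_mul _
    rw [inner_map_truncation, inner_map_truncation]
    have hsum : ∑ i ∈ Finset.range N, ∑ j ∈ Finset.range N, inner ℝ (P (e i)) (e j) *
        (inner ℝ (e i) (w t) * inner ℝ (e j) (w t)) =
        ∑ i ∈ Finset.range N, ∑ j ∈ Finset.range N, inner ℝ (P (e i)) (e j) *
        (inner ℝ (e i) (w 0) * inner ℝ (e j) (w 0)) +
        ∫ s in (0 : ℝ)..t, ∑ i ∈ Finset.range N, ∑ j ∈ Finset.range N, inner ℝ (P (e i)) (e j) *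
        ((-lam i * inner ℝ (e i) (w s) + b i ⬝ᵥ u s) * inner ℝ (e j) (w s) +
        inner ℝ (e i) (w s) * (-lam j * inner ℝ (e j) (w s) + b j ⬝ᵥ u s)) := by
      rw [intervalIntegral.integral_finsetSum fun i _ =>
        intervalIntegrable_finsetSum _ fun j _ => hint i j,
        ← Finset.sum_add_distrib]
      refine Finset.sum_congr rfl fun i _ => ?_
      rw [intervalIntegral.integral_finsetSum fun j _ => hint i j, ← Finset.sum_add_distrib]
      refine Finset.sum_congr rfl fun j _ => ?_
      rw [intervalIntegral.integral_const_mul, h.mul_modal i j ht]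
      ring
    rw [hsum]
    congr 1
    refine intervalIntegral.integral_congr fun s _ => ?_
    rw [inner_map_truncation]
    have e1 : ∑ k, u s k * inner ℝ (∑ i ∈ Finset.range N, b i k • P (e i)) (truncation e N (w s))
        = ∑ i ∈ Finset.range N, ∑ j ∈ Finset.range N,
          inner ℝ (P (e i)) (e j) * ((b i ⬝ᵥ u s) * inner ℝ (e j) (w s)) := by
      have e3 : ∀ i, inner ℝ (P (e i)) (truncation e N (w s)) =
          ∑ j ∈ Finset.range N, inner ℝ (P (e i)) (e j) * inner ℝ (e j) (w s) := fun i => by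
        simp only [truncation, inner_sum, inner_smul_right, mul_comm]
      simp only [sum_inner, inner_smul_left, conj_trivial, Finset.mul_sum]
      rw [Finset.sum_comm]
      refine Finset.sum_congr rfl fun i _ => ?_
      have e4 : ∑ k, u s k * (b i k * inner ℝ (P (e i)) (truncation e N (w s))) =
          (b i ⬝ᵥ u s) * inner ℝ (P (e i)) (truncation e N (w s)) := by
        rw [dotProduct, Finset.sum_mul]
        exact Finset.sum_congr rfl fun k _ => by ring
      rw [e4, e3, Finset.mul_sum]
      exact Finset.sum_congr rfl fun j _ => by ring
    have e2 : ∑ i ∈ Finset.range N, ∑ j ∈ Finset.range N,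
          inner ℝ (P (e i)) (e j) * (inner ℝ (e i) (w s) * (b j ⬝ᵥ u s)) =
        ∑ i ∈ Finset.range N, ∑ j ∈ Finset.range N,
          inner ℝ (P (e i)) (e j) * ((b i ⬝ᵥ u s) * inner ℝ (e j) (w s)) := by
      rw [Finset.sum_comm]
      refine Finset.sum_congr rfl fun i _ => Finset.sum_congr rfl fun j _ => ?_
      rw [hPs]
      ring
    rw [two_mul, e1]
    nth_rewrite 2 [← e2]
    rw [← Finset.sum_neg_distrib, ← Finset.sum_add_distrib, ← Finset.sum_add_distrib]
    refine Finset.sum_congr rfl fun i _ => ?_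
    rw [← Finset.sum_neg_distrib, ← Finset.sum_add_distrib, ← Finset.sum_add_distrib]
    refine Finset.sum_congr rfl fun j _ => ?_
    rw [← hPD]
    ring
  have hlim : ∀ (A : H →L[ℝ] H) x, Tendsto
      (fun N => inner ℝ (A (truncation e N x)) (truncation e N x)) atTop (𝓝 (inner ℝ (A x) x)) :=
    fun A x => ((A.continuous.tendsto x).comp (tendsto_truncation e x)).inner
      (tendsto_truncation e x)
  have hGN : ∀ k, Tendsto (fun N => ∑ i ∈ Finset.range N, b i k • P (e i)) atTop (𝓝 (G k)) :=
    fun k => (hG k).tendsto_sum_nat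
  have hGb : ∀ k, ∃ c, ∀ N, ‖∑ i ∈ Finset.range N, b i k • P (e i)‖ ≤ c := fun k => by
    obtain ⟨c, hc⟩ := (Metric.isBounded_range_of_tendsto _ (hGN k)).exists_norm_le
    exact ⟨c, fun N => hc _ ⟨N, rfl⟩⟩
  choose c hc using hGb
  have hwc := h.continuousOn_uIcc ht
  have hwm : AEStronglyMeasurable w (volume.restrict (uIoc 0 t)) :=
    (hwc.mono uIoc_subset_uIcc).aestronglyMeasurable measurableSet_uIoc
  have hum : ∀ k, AEStronglyMeasurable (fun s => u s k) (volume.restrict (uIoc 0 t)) := fun k => by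
    rw [uIoc_of_le ht]
    exact (h.memLp_control_apply k t).1
  have htm : ∀ N, AEStronglyMeasurable (fun s => truncation e N (w s))
      (volume.restrict (uIoc 0 t)) := fun N => by
    have : Continuous (truncation e N) := by unfold truncation; fun_prop
    exact this.comp_aestronglyMeasurable hwm
  refine tendsto_nhds_unique (hlim P (w t)) ?_
  simp only [trunc]
  refine (hlim P (w 0)).add ?_
  refine intervalIntegral.tendsto_integral_filter_of_dominated_convergence
    (fun s => ‖D‖ * ‖w s‖ * ‖w s‖ + 2 * ∑ k, |u s k| * (c k * ‖w s‖)) ?_ ?_ ?_ ?_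
  · refine Eventually.of_forall fun N => ?_
    have h1 : AEStronglyMeasurable (fun s => inner ℝ (D (truncation e N (w s)))
        (truncation e N (w s))) (volume.restrict (uIoc 0 t)) :=
      (D.continuous.comp_aestronglyMeasurable (htm N)).inner (htm N)
    have h2 : AEStronglyMeasurable (fun s => ∑ k, u s k *
        inner ℝ (∑ i ∈ Finset.range N, b i k • P (e i)) (truncation e N (w s)))
        (volume.restrict (uIoc 0 t)) := by
      refine Finset.aestronglyMeasurable_fun_sum _ fun k _ => (hum k).mul ?_
      exact aestronglyMeasurable_const.inner (htm N)
    exact h1.neg.add (h2.const_mul 2)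
  · refine Eventually.of_forall fun N => Eventually.of_forall fun s _ => ?_
    refine (norm_add_le _ _).trans (add_le_add ?_ ?_)
    · rw [norm_neg]
      refine (norm_inner_le_norm _ _).trans ?_
      have := norm_truncation_le e N (w s)
      have h2 := (D.le_opNorm (truncation e N (w s))).trans
        (mul_le_mul_of_nonneg_left this (norm_nonneg D))
      exact mul_le_mul h2 this (norm_nonneg _) (by positivity)
    · rw [norm_mul, Real.norm_ofNat]
      refine mul_le_mul_of_nonneg_left ((norm_sum_le _ _).trans (Finset.sum_le_sum fun k _ => ?_))
        (by norm_num)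
      rw [norm_mul]
      refine mul_le_mul_of_nonneg_left ((norm_inner_le_norm _ _).trans ?_) (norm_nonneg _)
      exact mul_le_mul (hc k N) (norm_truncation_le e N (w s)) (norm_nonneg _)
        ((norm_nonneg _).trans (hc k N))
  · have h1 : IntervalIntegrable (fun s => ‖D‖ * ‖w s‖ * ‖w s‖) volume 0 t :=
      ContinuousOn.intervalIntegrable (by fun_prop)
    refine h1.add (IntervalIntegrable.const_mul ?_ 2)
    have h2 : ∀ k ∈ Finset.univ, IntervalIntegrable (fun s => |u s k| * (c k * ‖w s‖))
        volume 0 t := fun k _ =>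
      (h.intervalIntegrable_control k ht).abs.mul_continuousOn (by fun_prop)
    exact intervalIntegrable_finsetSum _ h2
  · refine Eventually.of_forall fun s _ => ?_
    refine (hlim D (w s)).neg.add (Tendsto.const_mul 2 (tendsto_finsetSum _ fun k _ => ?_))
    exact ((hGN k).inner (tendsto_truncation e (w s))).const_mul _

/-! ### Finite cost forces the state to zero -/

theorem tendsto_zero_of_sq {α : Type*} {l : Filter α} {f : α → ℝ}
    (h : Tendsto (fun a => f a ^ 2) l (𝓝 0)) : Tendsto f l (𝓝 0) := by
  rw [tendsto_zero_iff_abs_tendsto_zero]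
  simpa [Function.comp_def, Real.sqrt_sq_eq_abs] using h.sqrt

namespace IsModalTrajectory

variable {H ι : Type*} [NormedAddCommGroup H] [InnerProductSpace ℝ H] [Fintype ι]
  {e : HilbertBasis ℕ ℝ H} {lam : ℕ → ℝ} {b : ℕ → ι → ℝ} {u : ℝ → ι → ℝ} {w : ℝ → H}

theorem memLp_input_Ioi (hu : MemLp u 2 (volume.restrict (Ioi 0))) (c : ι → ℝ) :
    MemLp (fun s => c ⬝ᵥ u s) 2 (volume.restrict (Ioi 0)) := by
  simp only [dotProduct]
  exact memLp_finsetSum _ fun k _ => (hu.eval k).const_mul (c k)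

theorem aestronglyMeasurable_inner (h : IsModalTrajectory e lam b u w) (x : H) :
    AEStronglyMeasurable (fun s => inner ℝ x (w s)) (volume.restrict (Ioi 0)) :=
  (continuousOn_const.inner (h.continuousOn.mono Ioi_subset_Ici_self)).aestronglyMeasurable
    measurableSet_Ioi

/-- The square of a coordinate and its derivative are integrable for a square integrable control
as soon as the square of the coordinate is; the coordinate then tends to zero. -/
theorem tendsto_inner_zero (h : IsModalTrajectory e lam b u w)
    (hu : MemLp u 2 (volume.restrict (Ioi 0))) (n : ℕ)
    (hw : IntegrableOn (fun s => inner ℝ (e n) (w s) ^ 2) (Ioi 0)) :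
    Tendsto (fun s => inner ℝ (e n) (w s)) atTop (𝓝 0) := by
  have hh := memLp_input_Ioi hu (b n)
  have hwL : MemLp (fun s => inner ℝ (e n) (w s)) 2 (volume.restrict (Ioi 0)) :=
    (memLp_two_iff_integrable_sq (h.aestronglyMeasurable_inner (e n))).2 hw
  have hp : IntegrableOn (fun s => -(2 * lam n) * inner ℝ (e n) (w s) ^ 2 +
      2 * ((b n ⬝ᵥ u s) * inner ℝ (e n) (w s))) (Ioi 0) :=
    (hw.const_mul _).add ((hh.integrable_mul hwL).const_mul 2)
  refine tendsto_zero_of_sq (tendsto_zero_of_integrableOn hw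
    (p := fun s => -(2 * lam n) * inner ℝ (e n) (w s) ^ 2 +
      2 * ((b n ⬝ᵥ u s) * inner ℝ (e n) (w s)))
    hp fun t ht => ?_)
  have := h.mul_modal n n ht
  simp only [sq]
  rw [this]
  congr 1
  refine intervalIntegral.integral_congr fun s _ => ?_
  ring

/-- The energy estimate of a single damped mode. -/
theorem sq_inner_add_le (h : IsModalTrajectory e lam b u w) {n : ℕ} (hn : 0 < lam n) {K : ℝ}
    (hK : ∀ T, 0 ≤ T → ∫ s in (0 : ℝ)..T, (b n ⬝ᵥ u s) ^ 2 ≤ K) {T : ℝ} (hT : 0 ≤ T) :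
    inner ℝ (e n) (w T) ^ 2 + lam n * ∫ s in (0 : ℝ)..T, inner ℝ (e n) (w s) ^ 2 ≤
      inner ℝ (e n) (w 0) ^ 2 + (lam n)⁻¹ * K := by
  have hc := h.continuousOn_inner (e n) hT
  have i1 : IntervalIntegrable (fun s => inner ℝ (e n) (w s) ^ 2) volume 0 T :=
    (hc.pow 2).intervalIntegrable
  have i2 : IntervalIntegrable (fun s => (b n ⬝ᵥ u s) ^ 2) volume 0 T := by
    rw [intervalIntegrable_iff_integrableOn_Ioc_of_le hT]
    exact (h.memLp_input (b n) T).integrable_sq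
  have i3 : IntervalIntegrable (fun s =>
      (-lam n * inner ℝ (e n) (w s) + b n ⬝ᵥ u s) * inner ℝ (e n) (w s) +
        inner ℝ (e n) (w s) * (-lam n * inner ℝ (e n) (w s) + b n ⬝ᵥ u s)) volume 0 T :=
    ((h.intervalIntegrable_modal n hT).mul_continuousOn hc).add
      ((h.intervalIntegrable_modal n hT).continuousOn_mul hc)
  have h1 : ∫ s in (0 : ℝ)..T, ((-lam n * inner ℝ (e n) (w s) + b n ⬝ᵥ u s) *
      inner ℝ (e n) (w s) + inner ℝ (e n) (w s) *
        (-lam n * inner ℝ (e n) (w s) + b n ⬝ᵥ u s)) ≤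
      ∫ s in (0 : ℝ)..T, (-lam n * inner ℝ (e n) (w s) ^ 2 + (lam n)⁻¹ * (b n ⬝ᵥ u s) ^ 2) := by
    refine intervalIntegral.integral_mono_on hT i3 ((i1.const_mul _).add (i2.const_mul _))
      fun s _ => ?_
    have h2 : 0 ≤ (lam n)⁻¹ * (lam n * inner ℝ (e n) (w s) - b n ⬝ᵥ u s) ^ 2 :=
      mul_nonneg (inv_nonneg.2 hn.le) (sq_nonneg _)
    have h3 : (lam n)⁻¹ * (lam n * inner ℝ (e n) (w s) - b n ⬝ᵥ u s) ^ 2 =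
        lam n * inner ℝ (e n) (w s) ^ 2 - 2 * (inner ℝ (e n) (w s) * (b n ⬝ᵥ u s)) +
          (lam n)⁻¹ * (b n ⬝ᵥ u s) ^ 2 := by
      field_simp
      ring
    linarith
  rw [intervalIntegral.integral_add (i1.const_mul _) (i2.const_mul _),
    intervalIntegral.integral_const_mul, intervalIntegral.integral_const_mul] at h1
  have h4 := h.mul_modal n n hT
  have h5 := mul_le_mul_of_nonneg_left (hK T hT) (inv_nonneg.2 hn.le)
  rw [sq (inner ℝ (e n) (w T)), sq (inner ℝ (e n) (w 0)), h4]
  linarith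

/-- A square integrable control and a state of finite observed energy `⟨M w, w⟩` force `w → 0`: the
modes `n ≥ 1` are damped by themselves, and the mode `n = 0` is seen by `M`. -/
theorem tendsto_zero (h : IsModalTrajectory e lam b u w) (hlam : ∀ n, n ≠ 0 → 0 < lam n)
    (hsum : Summable fun n => (lam n)⁻¹) {B : ℝ} (hB : ∀ n k, |b n k| ≤ B)
    (hu : MemLp u 2 (volume.restrict (Ioi 0))) (M : H →L[ℝ] H)
    (hM0 : ∀ x, 0 ≤ inner ℝ (M x) x) (hMe : 0 < inner ℝ (M (e 0)) (e 0))
    (hM : IntegrableOn (fun s => inner ℝ (M (w s)) (w s)) (Ioi 0)) :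
    Tendsto w atTop (𝓝 0) := by
  -- a bound for the energy of the inputs of all modes
  set K : ℝ := ∫ s in Ioi (0 : ℝ), (B * ∑ k, |u s k|) ^ 2
  have hKint : IntegrableOn (fun s => (B * ∑ k, |u s k|) ^ 2) (Ioi 0) := by
    have : MemLp (fun s => B * ∑ k, |u s k|) 2 (volume.restrict (Ioi 0)) :=
      (memLp_finsetSum _ fun k _ => (hu.eval k).abs).const_mul B
    exact this.integrable_sq
  have hle : ∀ n s, (b n ⬝ᵥ u s) ^ 2 ≤ (B * ∑ k, |u s k|) ^ 2 := fun n s => by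
    rw [← sq_abs (b n ⬝ᵥ u s)]
    refine pow_le_pow_left₀ (abs_nonneg _) ?_ 2
    rw [dotProduct, Finset.mul_sum]
    refine (Finset.abs_sum_le_sum_abs _ _).trans (Finset.sum_le_sum fun k _ => ?_)
    rw [abs_mul]
    exact mul_le_mul_of_nonneg_right (hB n k) (abs_nonneg _)
  have hK : ∀ n T, 0 ≤ T → ∫ s in (0 : ℝ)..T, (b n ⬝ᵥ u s) ^ 2 ≤ K := fun n T hT => by
    rw [intervalIntegral.integral_of_le hT]
    calc ∫ s in Ioc 0 T, (b n ⬝ᵥ u s) ^ 2 ≤ ∫ s in Ioc 0 T, (B * ∑ k, |u s k|) ^ 2 :=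
          integral_mono ((h.memLp_input (b n) T).integrable_sq)
            (hKint.mono_set Ioc_subset_Ioi_self) fun s => hle n s
      _ ≤ K := setIntegral_mono_set hKint (Eventually.of_forall fun s => sq_nonneg _)
          Ioc_subset_Ioi_self.eventuallyLE
  set a : ℕ → ℝ := fun n => inner ℝ (e n) (w 0) ^ 2 + (lam n)⁻¹ * K
  have ha : Summable a := (hasSum_inner_sq e (w 0)).summable.add (hsum.mul_right K)
  have hen : ∀ n, n ≠ 0 → ∀ T, 0 ≤ T →
      inner ℝ (e n) (w T) ^ 2 + lam n * ∫ s in (0 : ℝ)..T, inner ℝ (e n) (w s) ^ 2 ≤ a n :=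
    fun n hn T hT => h.sq_inner_add_le (hlam n hn) (hK n) hT
  have hI0 : ∀ n T, 0 ≤ T → 0 ≤ ∫ s in (0 : ℝ)..T, inner ℝ (e n) (w s) ^ 2 := fun n T hT =>
    intervalIntegral.integral_nonneg hT fun s _ => sq_nonneg _
  have hIle : ∀ n, n ≠ 0 → ∀ T, 0 ≤ T →
      ∫ s in (0 : ℝ)..T, inner ℝ (e n) (w s) ^ 2 ≤ (lam n)⁻¹ * a n := fun n hn T hT => by
    rw [inv_mul_eq_div, le_div_iff₀' (hlam n hn)]
    linarith [hen n hn T hT, sq_nonneg (inner ℝ (e n) (w T))]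
  -- the squares of the damped modes are integrable in time
  have hint : ∀ n, n ≠ 0 → IntegrableOn (fun s => inner ℝ (e n) (w s) ^ 2) (Ioi 0) :=
    fun n hn => by
    refine integrableOn_Ioi_of_intervalIntegral_norm_bounded ((lam n)⁻¹ * a n) 0
      (b := fun T : ℝ => max T 0) (l := atTop) (fun T => ?_)
      (tendsto_atTop_mono (fun T => le_max_left T 0) tendsto_id) (Eventually.of_forall fun T => ?_)
    · rw [← intervalIntegrable_iff_integrableOn_Ioc_of_le (le_max_right T 0)]
      exact ((h.continuousOn_inner (e n) (le_max_right T 0)).pow 2).intervalIntegrable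
    · simp only [norm_pow, Real.norm_eq_abs, sq_abs]
      exact hIle n hn _ (le_max_right T 0)
  have hintle : ∀ n, n ≠ 0 →
      ∫ s in Ioi (0 : ℝ), inner ℝ (e n) (w s) ^ 2 ≤ (lam n)⁻¹ * a n := fun n hn => by
    refine le_of_tendsto (intervalIntegral_tendsto_integral_Ioi 0 (hint n hn) tendsto_id) ?_
    filter_upwards [eventually_ge_atTop (0 : ℝ)] with T hT
    exact hIle n hn T hT
  -- the damped part of the state is square integrable in time
  have hperp : ∀ s, HasSum (fun n => inner ℝ (e (n + 1)) (w s) ^ 2)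
      (‖w s - inner ℝ (e 0) (w s) • e 0‖ ^ 2) := fun s => by
    have h1 := (hasSum_nat_add_iff' 1).2 (hasSum_inner_sq e (w s - inner ℝ (e 0) (w s) • e 0))
    have h0 : ∀ n, inner ℝ (e n) (w s - inner ℝ (e 0) (w s) • e 0) =
        inner ℝ (e n) (w s) - inner ℝ (e 0) (w s) * (if n = 0 then 1 else 0) := fun n => by
      rw [inner_sub_right, inner_smul_right, orthonormal_iff_ite.1 e.orthonormal]
    simpa [h0] using h1
  have hperpint : IntegrableOn (fun s => ‖w s - inner ℝ (e 0) (w s) • e 0‖ ^ 2) (Ioi 0) := by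
    have hm : AEStronglyMeasurable (fun s => ‖w s - inner ℝ (e 0) (w s) • e 0‖ ^ 2)
        (volume.restrict (Ioi 0)) := by
      have hc := h.continuousOn.mono (Ioi_subset_Ici_self (a := (0 : ℝ)))
      refine ContinuousOn.aestronglyMeasurable ?_ measurableSet_Ioi
      exact ((hc.sub ((continuousOn_const.inner hc).smul continuousOn_const)).norm).pow 2
    refine ⟨hm, ?_⟩
    rw [hasFiniteIntegral_iff_ofReal (Eventually.of_forall fun s => sq_nonneg _)]
    have h1 : ∀ s, ENNReal.ofReal (‖w s - inner ℝ (e 0) (w s) • e 0‖ ^ 2) =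
        ∑' n, ENNReal.ofReal (inner ℝ (e (n + 1)) (w s) ^ 2) := fun s => by
      rw [← (hperp s).tsum_eq, ENNReal.ofReal_tsum_of_nonneg (fun n => sq_nonneg _)
        (hperp s).summable]
    simp only [h1]
    have h2 : ∀ n, AEMeasurable (fun s => ENNReal.ofReal (inner ℝ (e (n + 1)) (w s) ^ 2))
        (volume.restrict (Ioi 0)) := fun n =>
      ((h.aestronglyMeasurable_inner (e (n + 1))).pow 2).aemeasurable.ennreal_ofReal
    rw [lintegral_tsum h2]
    have hs : Summable fun n => (lam (n + 1))⁻¹ * a (n + 1) := by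
      refine (summable_nat_add_iff 1 (f := fun n => (lam n)⁻¹ * a n)).2 ?_
      refine summable_of_isBigO_nat (g := a) ha ?_
      have : (fun n => (lam n)⁻¹) =O[atTop] fun _ => (1 : ℝ) :=
        hsum.tendsto_atTop_zero.isBigO_one ℝ
      simpa using this.mul (Asymptotics.isBigO_refl a atTop)
    refine lt_of_le_of_lt (ENNReal.tsum_le_tsum fun n => ?_) hs.tsum_ofReal_lt_top
    rw [← ofReal_integral_eq_lintegral_ofReal (hint _ n.succ_ne_zero)
      (Eventually.of_forall fun s => sq_nonneg _)]
    exact ENNReal.ofReal_le_ofReal (hintle _ n.succ_ne_zero)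
  -- the undamped mode
  have hint0 : IntegrableOn (fun s => inner ℝ (e 0) (w s) ^ 2) (Ioi 0) := by
    set m₀ := inner ℝ (M (e 0)) (e 0)
    refine Integrable.mono' (((hM.const_mul 2).add
      (hperpint.const_mul (2 * ‖M‖))).const_mul m₀⁻¹)
      ((h.aestronglyMeasurable_inner (e 0)).pow 2) (Eventually.of_forall fun s => ?_)
    simp only [Pi.add_apply, norm_pow, Real.norm_eq_abs, sq_abs]
    rw [inv_mul_eq_div, le_div_iff₀ hMe]
    set y := inner ℝ (e 0) (w s) • e 0 with hy
    have h1 : inner ℝ (M y) y = inner ℝ (e 0) (w s) ^ 2 * m₀ := by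
      rw [hy, map_smul, inner_smul_left, inner_smul_right]
      simp only [conj_trivial]
      ring
    rw [← h1]
    have h2 := hM0 (w s + (w s - y))
    have h3 : inner ℝ (M (w s - y)) (w s - y) ≤ ‖M‖ * ‖w s - y‖ ^ 2 := by
      refine (real_inner_le_norm _ _).trans ?_
      have := mul_le_mul_of_nonneg_right (M.le_opNorm (w s - y)) (norm_nonneg (w s - y))
      linarith
    have h4 : inner ℝ (M (w s + (w s - y))) (w s + (w s - y)) + inner ℝ (M y) y =
        2 * inner ℝ (M (w s)) (w s) + 2 * inner ℝ (M (w s - y)) (w s - y) := by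
      simp only [map_add, map_sub, inner_add_left, inner_add_right, inner_sub_left,
        inner_sub_right]
      ring
    linarith
  have hto : ∀ n, Tendsto (fun s => inner ℝ (e n) (w s)) atTop (𝓝 0) := fun n => by
    rcases eq_or_ne n 0 with rfl | hn
    · exact h.tendsto_inner_zero hu 0 hint0
    · exact h.tendsto_inner_zero hu n (hint n hn)
  have hd : Summable fun n => |a n| + if n = 0 then 1 else 0 :=
    ha.abs.add (hasSum_ite_eq 0 1).summable
  refine tendsto_of_tendsto_inner e hd (fun n => by simpa using hto n) ?_
  have hev : ∀ᶠ s in atTop, inner ℝ (e 0) (w s) ^ 2 < 1 := by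
    have := (hto 0).pow 2
    rw [zero_pow two_ne_zero] at this
    exact this.eventually_lt_const one_pos
  filter_upwards [hev, eventually_ge_atTop (0 : ℝ)] with s hs hs0 n
  rw [inner_zero_right, sub_zero]
  by_cases hn : n = 0
  · subst hn
    simp only [if_true]
    linarith [abs_nonneg (a 0)]
  · have h1 := hen n hn s hs0
    have h2 := mul_nonneg (hlam n hn).le (hI0 n s hs0)
    simp only [hn, if_false, add_zero]
    linarith [le_abs_self (a n)]

end IsModalTrajectory

/-! ### The rod in cosine coordinates -/

/-- Coordinates of the control operator: heat entering at `ξ_k` acts on the `n`-th mode through the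
value of the mode at `ξ_k`. -/
noncomputable def inputCoeff {m : ℕ} (ξ β : Fin (m + 1) → ℝ) (n : ℕ) (k : Fin (m + 1)) : ℝ :=
  β k * cosMode n (ξ k)

theorem exists_abs_inputCoeff_le {m : ℕ} (ξ β : Fin (m + 1) → ℝ) :
    ∃ B, 0 ≤ B ∧ ∀ n k, |inputCoeff ξ β n k| ≤ B := by
  refine ⟨∑ k, |β k| * 2, Finset.sum_nonneg fun k _ => by positivity, fun n k => ?_⟩
  rw [inputCoeff, abs_mul]
  refine (mul_le_mul_of_nonneg_left (abs_cosMode_le n _) (abs_nonneg _)).trans ?_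
  exact Finset.single_le_sum (f := fun k => |β k| * 2) (fun k _ => by positivity)
    (Finset.mem_univ k)

theorem IsTrajectory.isModalTrajectory {m : ℕ} {ξ β : Fin (m + 1) → ℝ} {z₀ : RodState}
    {u : ℝ → Fin (m + 1) → ℝ} {z : ℝ → RodState} (h : IsTrajectory ξ β z₀ u z) :
    IsModalTrajectory cosBasis eigenvalue (inputCoeff ξ β) u z where
  control_memLp := h.control_memLp
  continuousOn := h.continuousOn
  modal n t ht := by
    have := h.weak (cosMode n) (isNeumannTest_cosMode n) t ht
    rw [← inner_cosBasis, ← inner_cosBasis, ← h.initial] at this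
    rw [this]
    congr 1
    refine intervalIntegral.integral_congr fun s _ => ?_
    simp only [deriv_deriv_cosMode]
    congr 1
    · rw [inner_cosBasis, ← integral_const_mul]
      exact integral_congr_ae (Eventually.of_forall fun x => by ring)
    · exact Finset.sum_congr rfl fun k _ => by rw [inputCoeff]; ring

/-- The cosine coefficients of a Neumann test function are absolutely summable. -/
theorem IsNeumannTest.summable_inner_cosBasis {ψ : ℝ → ℝ} (hψ : IsNeumannTest ψ) :
    Summable fun n => |inner ℝ (cosBasis n) (toState ⟨ψ, hψ.contDiff.continuous⟩)| := by
  refine (summable_nat_add_iff 1).1 ?_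
  refine Summable.of_nonneg_of_le (fun n => abs_nonneg _) (fun n => ?_)
    (((summable_nat_add_iff 1).2 summable_inv_eigenvalue).mul_right
      ‖toState ⟨deriv (deriv ψ), hψ.continuous_deriv_deriv⟩‖)
  have hpos := eigenvalue_pos n.succ_ne_zero
  rw [inv_mul_eq_div, le_div_iff₀' hpos]
  have h1 := abs_real_inner_le_norm (cosBasis (n + 1))
    (toState ⟨deriv (deriv ψ), hψ.continuous_deriv_deriv⟩)
  rwa [hψ.inner_cosBasis_deriv, cosBasis.orthonormal.1, one_mul, abs_mul, abs_neg,
    abs_of_pos hpos] at h1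

/-- Conversely the modal equations imply the weak equation for every test function: they give it
for the partial sums of its cosine series, which converge at the points `ξ_k`. -/
theorem IsModalTrajectory.isTrajectory {m : ℕ} {ξ β : Fin (m + 1) → ℝ}
    (hξ : ∀ k, ξ k ∈ Icc (0 : ℝ) 1) {u : ℝ → Fin (m + 1) → ℝ} {z : ℝ → RodState}
    (h : IsModalTrajectory cosBasis eigenvalue (inputCoeff ξ β) u z) :
    IsTrajectory ξ β (z 0) u z where
  control_memLp := h.control_memLp
  continuousOn := h.continuousOn
  initial := rfl
  weak ψ hψ t ht := by
    set p := toState ⟨ψ, hψ.contDiff.continuous⟩ with hp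
    set q := toState ⟨deriv (deriv ψ), hψ.continuous_deriv_deriv⟩ with hq
    set a : ℕ → ℝ := fun n => inner ℝ (cosBasis n) p
    have e1 : ∀ s, ∫ x, z s x * ψ x ∂rodMeasure = inner ℝ p (z s) := fun s =>
      (inner_toState (z s) ⟨ψ, hψ.contDiff.continuous⟩).symm
    have e2 : ∀ s, ∫ x, z s x * deriv (deriv ψ) x ∂rodMeasure = inner ℝ q (z s) := fun s =>
      (inner_toState (z s) ⟨deriv (deriv ψ), hψ.continuous_deriv_deriv⟩).symm
    simp only [e1, e2]
    have hqn : ∀ n, inner ℝ (cosBasis n) q = -eigenvalue n * a n := fun n =>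
      hψ.inner_cosBasis_deriv n
    have hinner : ∀ N (f g : RodState), inner ℝ (truncation cosBasis N f) g =
        ∑ n ∈ Finset.range N, inner ℝ (cosBasis n) f * inner ℝ (cosBasis n) g := fun N f g => by
      simp only [truncation, sum_inner, inner_smul_left, conj_trivial]
    have trunc : ∀ N, inner ℝ (truncation cosBasis N p) (z t) =
        inner ℝ (truncation cosBasis N p) (z 0) +
        ∫ s in (0 : ℝ)..t, (inner ℝ (truncation cosBasis N q) (z s) +
          ∑ k, β k * u s k * ∑ n ∈ Finset.range N, a n * cosMode n (ξ k)) := fun N => by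
      have h1 : ∀ s, inner ℝ (truncation cosBasis N q) (z s) +
          ∑ k, β k * u s k * ∑ n ∈ Finset.range N, a n * cosMode n (ξ k) =
          ∑ n ∈ Finset.range N, a n * (-eigenvalue n * inner ℝ (cosBasis n) (z s) +
            inputCoeff ξ β n ⬝ᵥ u s) := fun s => by
        simp only [hinner, mul_add, Finset.sum_add_distrib, dotProduct, Finset.mul_sum]
        congr 1
        · exact Finset.sum_congr rfl fun n _ => by rw [hqn]; ring
        · rw [Finset.sum_comm]
          exact Finset.sum_congr rfl fun n _ => Finset.sum_congr rfl fun k _ => by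
            rw [inputCoeff]; ring
      simp only [h1]
      rw [intervalIntegral.integral_finsetSum fun n _ =>
        (h.intervalIntegrable_modal n ht).const_mul (a n), hinner, hinner,
        ← Finset.sum_add_distrib]
      refine Finset.sum_congr rfl fun n _ => ?_
      rw [intervalIntegral.integral_const_mul, h.modal n t ht]
      ring
    have hser : ∀ k, Tendsto (fun N => ∑ n ∈ Finset.range N, a n * cosMode n (ξ k)) atTop
        (𝓝 (ψ (ξ k))) := fun k =>
      (hasSum_cosine_series _ hψ.summable_inner_cosBasis (hξ k)).tendsto_sum_nat
    have hserb : ∀ k, ∃ c, ∀ N, ‖∑ n ∈ Finset.range N, a n * cosMode n (ξ k)‖ ≤ c := fun k => by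
      obtain ⟨c, hc⟩ := (Metric.isBounded_range_of_tendsto _ (hser k)).exists_norm_le
      exact ⟨c, fun N => hc _ ⟨N, rfl⟩⟩
    choose c hc using hserb
    have hlim : ∀ f g : RodState, Tendsto (fun N => inner ℝ (truncation cosBasis N f) g) atTop
        (𝓝 (inner ℝ f g)) := fun f g => (tendsto_truncation cosBasis f).inner tendsto_const_nhds
    have hzc := h.continuousOn_uIcc ht
    refine tendsto_nhds_unique (hlim p (z t)) ?_
    simp only [trunc]
    refine (hlim p (z 0)).add ?_
    refine intervalIntegral.tendsto_integral_filter_of_dominated_convergence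
      (fun s => ‖q‖ * ‖z s‖ + ∑ k, |β k * u s k| * c k) ?_ ?_ ?_ ?_
    · refine Eventually.of_forall fun N => AEStronglyMeasurable.add ?_ ?_
      · exact ((h.continuousOn_inner _ ht).mono uIoc_subset_uIcc).aestronglyMeasurable
          measurableSet_uIoc
      · refine Finset.aestronglyMeasurable_fun_sum _ fun k _ => ?_
        rw [uIoc_of_le ht]
        exact ((h.memLp_control_apply k t).1.const_mul (β k)).mul_const _
    · refine Eventually.of_forall fun N => Eventually.of_forall fun s _ => ?_
      refine (norm_add_le _ _).trans (add_le_add ?_ ?_)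
      · exact (norm_inner_le_norm _ _).trans (mul_le_mul_of_nonneg_right
          (norm_truncation_le cosBasis N q) (norm_nonneg _))
      · refine (norm_sum_le _ _).trans (Finset.sum_le_sum fun k _ => ?_)
        rw [norm_mul]
        exact mul_le_mul_of_nonneg_left (hc k N) (norm_nonneg _)
    · have h1 : IntervalIntegrable (fun s => ‖q‖ * ‖z s‖) volume 0 t :=
        ContinuousOn.intervalIntegrable (by fun_prop)
      exact h1.add (intervalIntegrable_finsetSum _ fun k _ =>
        ((h.intervalIntegrable_control k ht).const_mul (β k)).abs.mul_const (c k))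
    · refine Eventually.of_forall fun s _ => ?_
      exact (hlim q (z s)).add (tendsto_finsetSum _ fun k _ => (hser k).const_mul _)

/-! ### Integral and multiplication operators -/

/-- The continuous function `x ↦ ∫ k(x,y) f(y) dy`. -/
noncomputable def kernelFun (k : BoundedContinuousFunction (ℝ × ℝ) ℝ) (f : RodState) :
    C(ℝ, ℝ) where
  toFun x := ∫ y, f y * k (x, y) ∂rodMeasure
  continuous_toFun := by
    have hf : Integrable f rodMeasure := (Lp.memLp f).integrable (by norm_num)
    refine continuous_of_dominated (bound := fun y => ‖f y‖ * ‖k‖) (fun x => ?_) (fun x => ?_)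
      (hf.norm.mul_const _) ?_
    · exact hf.1.mul (by fun_prop : Continuous fun y => k (x, y)).aestronglyMeasurable
    · refine Eventually.of_forall fun y => ?_
      rw [norm_mul]
      exact mul_le_mul_of_nonneg_left (k.norm_coe_le_norm _) (norm_nonneg _)
    · exact Eventually.of_forall fun y => by fun_prop

/-- The section `k(x,·)` of a kernel as an element of `L²(0,1)`. -/
noncomputable def kernelSection (k : BoundedContinuousFunction (ℝ × ℝ) ℝ) (x : ℝ) : RodState :=
  toState ⟨fun y => k (x, y), by fun_prop⟩

theorem kernelFun_apply (k : BoundedContinuousFunction (ℝ × ℝ) ℝ) (f : RodState) (x : ℝ) :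
    kernelFun k f x = inner ℝ (kernelSection k x) f := by
  rw [kernelSection, inner_toState]
  rfl

theorem norm_kernelSection_le (k : BoundedContinuousFunction (ℝ × ℝ) ℝ) (x : ℝ) :
    ‖kernelSection k x‖ ≤ ‖k‖ :=
  norm_toState_le _ (norm_nonneg _) fun y _ => k.norm_coe_le_norm (x, y)

/-- The integral operator with a bounded continuous kernel. -/
noncomputable def kernelOp (k : BoundedContinuousFunction (ℝ × ℝ) ℝ) : RodState →L[ℝ] RodState :=
  LinearMap.mkContinuous
    { toFun := fun f => toState (kernelFun k f)
      map_add' := fun f g => by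
        rw [← map_add]
        congr 1
        ext x
        simp only [ContinuousMap.add_apply, kernelFun_apply, inner_add_right]
      map_smul' := fun c f => by
        rw [RingHom.id_apply, ← map_smul]
        congr 1
        ext x
        simp only [ContinuousMap.smul_apply, kernelFun_apply, inner_smul_right, smul_eq_mul] }
    ‖k‖ fun f => by
      refine norm_toState_le _ (by positivity) fun x _ => ?_
      rw [kernelFun_apply]
      exact (abs_real_inner_le_norm _ _).trans
        (mul_le_mul_of_nonneg_right (norm_kernelSection_le k x) (norm_nonneg _))

theorem kernelOp_apply (k : BoundedContinuousFunction (ℝ × ℝ) ℝ) (f : RodState) :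
    kernelOp k f = toState (kernelFun k f) := rfl

theorem inner_kernelOp (k : BoundedContinuousFunction (ℝ × ℝ) ℝ) (f g : RodState) :
    inner ℝ (kernelOp k f) g = ∫ x, ∫ y, g x * k (x, y) * f y ∂rodMeasure ∂rodMeasure := by
  rw [kernelOp_apply, inner_toState]
  refine integral_congr_ae (Eventually.of_forall fun x => ?_)
  simp only
  rw [show kernelFun k f x = ∫ y, f y * k (x, y) ∂rodMeasure from rfl, ← integral_const_mul]
  exact integral_congr_ae (Eventually.of_forall fun y => by ring)

theorem inner_kernelOp_comm {k : BoundedContinuousFunction (ℝ × ℝ) ℝ}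
    (hk : ∀ x y, k (x, y) = k (y, x)) (f g : RodState) :
    inner ℝ (kernelOp k f) g = inner ℝ (kernelOp k g) f := by
  have hf : Integrable f rodMeasure := (Lp.memLp f).integrable (by norm_num)
  have hg : Integrable g rodMeasure := (Lp.memLp g).integrable (by norm_num)
  rw [inner_kernelOp, inner_kernelOp, integral_integral_swap]
  · refine integral_congr_ae (Eventually.of_forall fun x => ?_)
    refine integral_congr_ae (Eventually.of_forall fun y => ?_)
    simp only
    rw [hk]
    ring
  · have h1 := (hg.mul_prod hf).bdd_mul (c := ‖k‖) k.continuous.aestronglyMeasurable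
      (Eventually.of_forall fun p => k.norm_coe_le_norm p)
    refine h1.congr (Eventually.of_forall fun p => ?_)
    simp only [Function.uncurry]
    ring

/-- Multiplication by a bounded measurable function. -/
theorem exists_mulOp {Q : ℝ → ℝ} (hQ : AEMeasurable Q rodMeasure) {C : ℝ}
    (hC : ∀ x ∈ Icc (0 : ℝ) 1, |Q x| ≤ C) :
    ∃ M : RodState →L[ℝ] RodState, ∀ f g,
      inner ℝ (M f) g = ∫ x, g x * Q x * f x ∂rodMeasure := by
  have hC' : ∀ᵐ x ∂rodMeasure, |Q x| ≤ C :=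
    (ae_restrict_iff' measurableSet_Icc).2 (Eventually.of_forall hC)
  have hle : ∀ f : RodState, ∀ᵐ x ∂rodMeasure, ‖Q x * f x‖ ≤ C * ‖f x‖ := fun f => by
    filter_upwards [hC'] with x hx
    rw [norm_mul]
    exact mul_le_mul_of_nonneg_right hx (norm_nonneg _)
  have hm : ∀ f : RodState, MemLp (fun x => Q x * f x) 2 rodMeasure := fun f =>
    (Lp.memLp f).of_le_mul (hQ.aestronglyMeasurable.mul (Lp.memLp f).1) (hle f)
  refine ⟨LinearMap.mkContinuous
    { toFun := fun f => (hm f).toLp _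
      map_add' := fun f g => ?_
      map_smul' := fun c f => ?_ } C fun f => ?_, fun f g => ?_⟩
  · rw [← MemLp.toLp_add (hm f) (hm g), MemLp.toLp_eq_toLp_iff]
    filter_upwards [Lp.coeFn_add f g] with x hx
    rw [hx, Pi.add_apply, Pi.add_apply, mul_add]
  · rw [RingHom.id_apply, ← MemLp.toLp_const_smul c (hm f), MemLp.toLp_eq_toLp_iff]
    filter_upwards [Lp.coeFn_smul c f] with x hx
    rw [hx, Pi.smul_apply, Pi.smul_apply, smul_eq_mul, smul_eq_mul]
    ring
  · refine Lp.norm_le_mul_norm_of_ae_le_mul ?_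
    filter_upwards [hle f, (hm f).coeFn_toLp] with x hx hx'
    change ‖(hm f).toLp _ x‖ ≤ _
    rwa [hx']
  · rw [L2.inner_def]
    refine integral_congr_ae ?_
    filter_upwards [(hm f).coeFn_toLp] with x hx
    change inner ℝ ((hm f).toLp _ x) (g x) = _
    rw [hx, Real.inner_apply]
    ring

/-! ### The Riccati equation in cosine coordinates -/

section Abstract

variable {H : Type*} [NormedAddCommGroup H] [InnerProductSpace ℝ H]

/-- Regularity of solutions of the Lyapunov equation `Λ P + P Λ = D`: they gain the two derivatives
measured by `Λ`. -/
theorem norm_map_basis_le (e : HilbertBasis ℕ ℝ H) {lam : ℕ → ℝ} (hlam : ∀ n, 0 ≤ lam n)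
    {P D : H →L[ℝ] H}
    (hPD : ∀ i j, (lam i + lam j) * inner ℝ (P (e i)) (e j) = inner ℝ (D (e i)) (e j))
    {i : ℕ} (hi : 0 < lam i) : ‖P (e i)‖ ≤ ‖D‖ * (lam i)⁻¹ := by
  have h1 : lam i * ‖P (e i)‖ ≤ ‖D (e i)‖ := by
    refine le_of_sq_le_sq ?_ (norm_nonneg _)
    rw [mul_pow, ← (hasSum_inner_sq e (P (e i))).tsum_eq, ← (hasSum_inner_sq e (D (e i))).tsum_eq,
      ← tsum_mul_left]
    refine ((hasSum_inner_sq e _).summable.mul_left _).tsum_le_tsum (fun j => ?_)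
      (hasSum_inner_sq e _).summable
    rw [real_inner_comm, real_inner_comm (D (e i)), ← hPD i j, mul_pow]
    exact mul_le_mul_of_nonneg_right (pow_le_pow_left₀ hi.le (by linarith [hlam j]) 2)
      (sq_nonneg _)
  have h2 := D.le_opNorm (e i)
  rw [e.orthonormal.1, mul_one] at h2
  rw [← div_eq_mul_inv, le_div_iff₀' hi]
  exact h1.trans h2

variable {ι : Type*} [Fintype ι]

/-- The operator `M - G A G'` for vectors `G = (G_k)` and a matrix `A`. -/
noncomputable def riccatiOp (M : H →L[ℝ] H) (A : Matrix ι ι ℝ) (G : ι → H) : H →L[ℝ] H :=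
  M - ∑ k, ∑ l, A k l • (innerSL ℝ (G l)).smulRight (G k)

theorem inner_riccatiOp (M : H →L[ℝ] H) (A : Matrix ι ι ℝ) (G : ι → H) (x y : H) :
    inner ℝ (riccatiOp M A G x) y = inner ℝ (M x) y -
      (fun k => inner ℝ (G k) y) ⬝ᵥ A.mulVec fun k => inner ℝ (G k) x := by
  simp only [riccatiOp, sub_apply, sum_apply,
    smul_apply, ContinuousLinearMap.smulRight_apply, innerSL_apply_apply,
    inner_sub_left, sum_inner, inner_smul_left, conj_trivial, dotProduct, Matrix.mulVec,
    Finset.mul_sum]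
  congr 1
  refine Finset.sum_congr rfl fun k _ => Finset.sum_congr rfl fun l _ => ?_
  ring

end Abstract

/-- A kernel that is continuous on the unit square is extended to the plane by composing it with
the projection onto the square. -/
theorem exists_kernel {P : ℝ → ℝ → ℝ}
    (hPc : ContinuousOn (fun p : ℝ × ℝ => P p.1 p.2) (Icc 0 1 ×ˢ Icc 0 1))
    (hPs : ∀ x ∈ Icc (0 : ℝ) 1, ∀ y ∈ Icc (0 : ℝ) 1, P x y = P y x) :
    ∃ k : BoundedContinuousFunction (ℝ × ℝ) ℝ,
      (∀ x ∈ Icc (0 : ℝ) 1, ∀ y ∈ Icc (0 : ℝ) 1, k (x, y) = P x y) ∧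
      ∀ x y, k (x, y) = k (y, x) := by
  set c : ℝ → ℝ := fun x => projIcc 0 1 zero_le_one x with hc
  have hcm : ∀ x, c x ∈ Icc (0 : ℝ) 1 := fun x => (projIcc 0 1 zero_le_one x).2
  have hcc : Continuous c := continuous_subtype_val.comp continuous_projIcc
  have hcont : Continuous fun p : ℝ × ℝ => P (c p.1) (c p.2) :=
    hPc.comp_continuous (f := fun p : ℝ × ℝ => (c p.1, c p.2)) (by fun_prop)
      fun p => ⟨hcm _, hcm _⟩
  obtain ⟨B, hB⟩ := (isCompact_Icc.prod isCompact_Icc).exists_bound_of_continuousOn hPc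
  refine ⟨BoundedContinuousFunction.ofNormedAddCommGroup _ hcont B
    fun p => hB (c p.1, c p.2) ⟨hcm _, hcm _⟩, fun x hx y hy => ?_, fun x y => ?_⟩
  · have h1 : c x = x := by simp [hc, projIcc_of_mem zero_le_one hx]
    have h2 : c y = y := by simp [hc, projIcc_of_mem zero_le_one hy]
    change P (c x) (c y) = P x y
    rw [h1, h2]
  · exact hPs _ (hcm x) _ (hcm y)

theorem integral_rod_congr {f g : ℝ → ℝ} (h : ∀ x ∈ Icc (0 : ℝ) 1, f x = g x) :
    ∫ x, f x ∂rodMeasure = ∫ x, g x ∂rodMeasure :=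
  setIntegral_congr_fun measurableSet_Icc h

theorem integrable_rod (f : C(ℝ, ℝ)) : Integrable f rodMeasure :=
  (memLp_continuousMap f).integrable (by norm_num)

theorem quadForm_eq {P : ℝ → ℝ → ℝ} {k : BoundedContinuousFunction (ℝ × ℝ) ℝ}
    (hk : ∀ x ∈ Icc (0 : ℝ) 1, ∀ y ∈ Icc (0 : ℝ) 1, k (x, y) = P x y) (f : RodState) :
    quadForm P f = inner ℝ (kernelOp k f) f := by
  rw [inner_kernelOp, quadForm]
  exact integral_rod_congr fun x hx => integral_rod_congr fun y hy => by rw [hk x hx y hy]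

section Riccati

variable {m : ℕ} {ξ β : Fin (m + 1) → ℝ} {Q : ℝ → ℝ} {R : Matrix (Fin (m + 1)) (Fin (m + 1)) ℝ}
  {P : ℝ → ℝ → ℝ} {k : BoundedContinuousFunction (ℝ × ℝ) ℝ} {M : RodState →L[ℝ] RodState}

/-- The vectors `G_i = β_i P(ξ_i, ·)`. -/
noncomputable def inputSection (ξ β : Fin (m + 1) → ℝ) (k : BoundedContinuousFunction (ℝ × ℝ) ℝ)
    (i : Fin (m + 1)) : RodState :=
  β i • kernelSection k (ξ i)

theorem inner_inputSection_toState (hξ : ∀ i, ξ i ∈ Icc (0 : ℝ) 1)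
    (hk : ∀ x ∈ Icc (0 : ℝ) 1, ∀ y ∈ Icc (0 : ℝ) 1, k (x, y) = P x y) (f : RodState)
    (i : Fin (m + 1)) :
    inner ℝ (inputSection ξ β k i) f = ∫ x, β i * P (ξ i) x * f x ∂rodMeasure := by
  rw [inputSection, inner_smul_left, kernelSection, inner_toState, conj_trivial,
    ← integral_const_mul]
  refine integral_rod_congr fun x hx => ?_
  rw [ContinuousMap.coe_mk, hk _ (hξ i) x hx]
  ring

/-- The weak Riccati equation as an identity of quadratic forms. -/
theorem IsWeakRiccatiSolution.inner_eq_zero (hP : IsWeakRiccatiSolution ξ β Q R P)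
    (hξ : ∀ i, ξ i ∈ Icc (0 : ℝ) 1)
    (hk : ∀ x ∈ Icc (0 : ℝ) 1, ∀ y ∈ Icc (0 : ℝ) 1, k (x, y) = P x y)
    (hks : ∀ x y, k (x, y) = k (y, x))
    (hM : ∀ f g, inner ℝ (M f) g = ∫ x, g x * Q x * f x ∂rodMeasure) {ψ φ : C(ℝ, ℝ)}
    (hψ : IsNeumannTest ψ) (hφ : deriv (deriv ψ) = φ) :
    2 * inner ℝ (kernelOp k (toState ψ)) (toState φ) +
      inner ℝ (riccatiOp M R⁻¹ (inputSection ξ β k) (toState ψ)) (toState ψ) = 0 := by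
  have h := hP ψ hψ
  rw [hφ] at h
  have hsec : ∀ (f : C(ℝ, ℝ)) x, kernelFun k (toState f) x = ∫ y, k (x, y) * f y ∂rodMeasure := by
    intro f x
    refine integral_congr_ae ?_
    filter_upwards [coeFn_toState f] with y hy
    rw [hy, mul_comm]
  have hkint : ∀ (f : C(ℝ, ℝ)) x, Integrable (fun y => k (x, y) * f y) rodMeasure := fun f x =>
    integrable_rod ⟨fun y => k (x, y) * f y, by fun_prop⟩
  have hlap : ∫ x₁, ∫ x₂, P x₁ x₂ * (φ x₁ * ψ x₂ + ψ x₁ * φ x₂) ∂rodMeasure ∂rodMeasure =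
      2 * inner ℝ (kernelOp k (toState ψ)) (toState φ) := by
    have h1 : ∫ x₁, ∫ x₂, P x₁ x₂ * (φ x₁ * ψ x₂ + ψ x₁ * φ x₂) ∂rodMeasure ∂rodMeasure =
        ∫ x, (φ x * kernelFun k (toState ψ) x + ψ x * kernelFun k (toState φ) x) ∂rodMeasure := by
      refine integral_rod_congr fun x hx => ?_
      rw [hsec, hsec, ← integral_const_mul, ← integral_const_mul,
        ← integral_add ((hkint ψ x).const_mul _) ((hkint φ x).const_mul _)]
      refine integral_rod_congr fun y hy => ?_
      rw [hk x hx y hy]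
      ring
    have i1 : ∀ f g : C(ℝ, ℝ), Integrable (fun x => f x * g x) rodMeasure := fun f g =>
      integrable_rod (f * g)
    rw [h1, integral_add (i1 φ _) (i1 ψ _)]
    have h2 : ∀ f g : C(ℝ, ℝ), ∫ x, f x * kernelFun k (toState g) x ∂rodMeasure =
        inner ℝ (kernelOp k (toState g)) (toState f) := fun f g => by
      rw [kernelOp_apply, inner_toState_toState]
    rw [h2, h2, inner_kernelOp_comm hks (toState φ), two_mul]
  have hsource : ∫ x, Q x * ψ x * ψ x ∂rodMeasure = inner ℝ (M (toState ψ)) (toState ψ) := by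
    rw [hM]
    refine integral_congr_ae ?_
    filter_upwards [coeFn_toState ψ] with x hx
    rw [hx]
    ring
  have hG : ∀ i, inner ℝ (inputSection ξ β k i) (toState ψ) =
      ∫ x, β i * k (ξ i, x) * ψ x ∂rodMeasure := fun i => by
    rw [inputSection, inner_smul_left, kernelSection, inner_toState_toState, conj_trivial,
      ← integral_const_mul]
    refine integral_rod_congr fun x _ => ?_
    change β i * (ψ x * k (ξ i, x)) = _
    ring
  have hγ : ∀ i, Integrable (fun x => β i * k (ξ i, x) * ψ x) rodMeasure := fun i =>
    integrable_rod ⟨fun x => β i * k (ξ i, x) * ψ x, by fun_prop⟩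
  have hquad : ∫ x₁, ∫ x₂, ((Matrix.diagonal β).mulVec (Pbar ξ P x₁) ⬝ᵥ
      R⁻¹.mulVec ((Matrix.diagonal β).mulVec (Pbar ξ P x₂))) * (ψ x₁ * ψ x₂)
        ∂rodMeasure ∂rodMeasure =
      (fun i => inner ℝ (inputSection ξ β k i) (toState ψ)) ⬝ᵥ
        R⁻¹.mulVec fun i => inner ℝ (inputSection ξ β k i) (toState ψ) := by
    generalize R⁻¹ = A
    have h1 : ∀ x₁ ∈ Icc (0 : ℝ) 1, ∫ x₂, ((Matrix.diagonal β).mulVec (Pbar ξ P x₁) ⬝ᵥ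
        A.mulVec ((Matrix.diagonal β).mulVec (Pbar ξ P x₂))) * (ψ x₁ * ψ x₂) ∂rodMeasure =
        ∑ i, β i * k (ξ i, x₁) * ψ x₁ *
          A.mulVec (fun i => inner ℝ (inputSection ξ β k i) (toState ψ)) i := by
      intro x₁ hx₁
      have h2 : ∀ x₂ ∈ Icc (0 : ℝ) 1, ((Matrix.diagonal β).mulVec (Pbar ξ P x₁) ⬝ᵥ
          A.mulVec ((Matrix.diagonal β).mulVec (Pbar ξ P x₂))) * (ψ x₁ * ψ x₂) =
          ∑ i, ∑ j, β i * k (ξ i, x₁) * ψ x₁ * (A i j * (β j * k (ξ j, x₂) * ψ x₂)) := by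
        intro x₂ hx₂
        simp only [dotProduct, Matrix.mulVec_diagonal, Pbar, Finset.sum_mul]
        refine Finset.sum_congr rfl fun i _ => ?_
        simp only [Matrix.mulVec, dotProduct, Matrix.diagonal_apply, ite_mul, zero_mul,
          Finset.sum_ite_eq, Finset.mem_univ, if_true, Finset.mul_sum, Finset.sum_mul, Pbar]
        refine Finset.sum_congr rfl fun j _ => ?_
        rw [hk _ (hξ i) _ hx₁, hk _ (hξ j) _ hx₂]
        ring
      have i1 : ∀ i j, Integrable (fun x => β i * k (ξ i, x₁) * ψ x₁ *
          (A i j * (β j * k (ξ j, x) * ψ x))) rodMeasure := fun i j =>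
        ((hγ j).const_mul (A i j)).const_mul _
      rw [integral_rod_congr h2, integral_finsetSum _ fun i _ =>
        integrable_finsetSum _ fun j _ => i1 i j]
      refine Finset.sum_congr rfl fun i _ => ?_
      rw [integral_finsetSum _ fun j _ => i1 i j, Matrix.mulVec, dotProduct, Finset.mul_sum]
      refine Finset.sum_congr rfl fun j _ => ?_
      rw [integral_const_mul, integral_const_mul, hG]
    rw [integral_rod_congr h1, integral_finsetSum _ fun i _ => (hγ i).mul_const _, dotProduct]
    refine Finset.sum_congr rfl fun i _ => ?_
    rw [integral_mul_const, hG]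
  rw [hlap, hsource, hquad] at h
  rw [inner_riccatiOp]
  linarith

/-- Polarization of the weak Riccati equation: the matrix of `P` in the cosine basis solves a
Lyapunov equation. -/
theorem IsWeakRiccatiSolution.lyapunov (hP : IsWeakRiccatiSolution ξ β Q R P)
    (hξ : ∀ i, ξ i ∈ Icc (0 : ℝ) 1) (hR : R.IsHermitian)
    (hk : ∀ x ∈ Icc (0 : ℝ) 1, ∀ y ∈ Icc (0 : ℝ) 1, k (x, y) = P x y)
    (hks : ∀ x y, k (x, y) = k (y, x))
    (hM : ∀ f g, inner ℝ (M f) g = ∫ x, g x * Q x * f x ∂rodMeasure) (i j : ℕ) :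
    (eigenvalue i + eigenvalue j) * inner ℝ (kernelOp k (cosBasis i)) (cosBasis j) =
      inner ℝ (riccatiOp M R⁻¹ (inputSection ξ β k) (cosBasis i)) (cosBasis j) := by
  set D := riccatiOp M R⁻¹ (inputSection ξ β k) with hD
  have hMs : ∀ f g, inner ℝ (M f) g = inner ℝ (M g) f := fun f g => by
    rw [hM, hM]
    exact integral_congr_ae (Eventually.of_forall fun x => by ring)
  have hRs : (R⁻¹).IsSymm := by
    have := hR.inv
    rwa [Matrix.IsHermitian, Matrix.conjTranspose_eq_transpose_of_trivial] at this
  have hDs : ∀ f g, inner ℝ (D f) g = inner ℝ (D g) f := fun f g => by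
    rw [hD, inner_riccatiOp, inner_riccatiOp, hMs, Matrix.dotProduct_mulVec,
      ← Matrix.mulVec_transpose, hRs.eq, dotProduct_comm]
  have hPs := inner_kernelOp_comm hks
  have hd : ∀ n, deriv (deriv (cosMode n)) = (-eigenvalue n • cosMode n : C(ℝ, ℝ)) := fun n => by
    rw [deriv_deriv_cosMode]
    rfl
  have hdiag : ∀ n, -(2 * eigenvalue n) * inner ℝ (kernelOp k (cosBasis n)) (cosBasis n) +
      inner ℝ (D (cosBasis n)) (cosBasis n) = 0 := fun n => by
    have := hP.inner_eq_zero hξ hk hks hM (isNeumannTest_cosMode n) (hd n)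
    rw [map_smul, inner_smul_right, ← cosBasis_apply] at this
    rw [← this]
    ring
  have hN : IsNeumannTest (cosMode i + cosMode j : C(ℝ, ℝ)) :=
    (isNeumannTest_cosMode i).add (isNeumannTest_cosMode j)
  have hdd : deriv (deriv (cosMode i + cosMode j : C(ℝ, ℝ))) =
      (-eigenvalue i • cosMode i + -eigenvalue j • cosMode j : C(ℝ, ℝ)) := by
    have h1 : ∀ n, Differentiable ℝ (cosMode n) := fun n =>
      (isNeumannTest_cosMode n).contDiff.differentiable (by norm_num)
    have h2 : ∀ n, Differentiable ℝ (deriv (cosMode n)) := fun n =>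
      (isNeumannTest_cosMode n).contDiff_deriv.differentiable (by norm_num)
    have h3 : deriv (cosMode i + cosMode j : C(ℝ, ℝ)) = deriv (cosMode i) + deriv (cosMode j) :=
      funext fun x => deriv_add (h1 i x) (h1 j x)
    rw [h3]
    funext x
    rw [deriv_add (h2 i x) (h2 j x), hd, hd]
    rfl
  have hsum := hP.inner_eq_zero hξ hk hks hM hN hdd
  simp only [map_add, map_smul, ← cosBasis_apply, ← hD, inner_add_left, inner_add_right, inner_smul_right] at hsum
  have h1 := hdiag i
  have h2 := hdiag j
  rw [hPs (cosBasis j) (cosBasis i), hDs (cosBasis j) (cosBasis i)] at hsum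
  linarith

/-- The series `∑ b_i P e_i` of `P` applied to a point source at `ξ_l` converges in norm to
`β_l P(ξ_l, ·)`, although the point source itself is not in `L²(0,1)`. -/
theorem hasSum_inputCoeff_smul (hξ : ∀ i, ξ i ∈ Icc (0 : ℝ) 1)
    (hks : ∀ x y, k (x, y) = k (y, x)) {D : RodState →L[ℝ] RodState}
    (hPD : ∀ i j, (eigenvalue i + eigenvalue j) *
      inner ℝ (kernelOp k (cosBasis i)) (cosBasis j) = inner ℝ (D (cosBasis i)) (cosBasis j))
    (l : Fin (m + 1)) :
    HasSum (fun i => inputCoeff ξ β i l • kernelOp k (cosBasis i)) (inputSection ξ β k l) := by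
  have hnorm : Summable fun i => ‖kernelOp k (cosBasis i)‖ := by
    refine (summable_nat_add_iff 1).1 ?_
    exact Summable.of_nonneg_of_le (fun _ => norm_nonneg _)
      (fun i => norm_map_basis_le cosBasis eigenvalue_nonneg hPD (eigenvalue_pos i.succ_ne_zero))
      (((summable_nat_add_iff 1).2 summable_inv_eigenvalue).mul_left ‖D‖)
  have hs : Summable fun i => inputCoeff ξ β i l • kernelOp k (cosBasis i) := by
    obtain ⟨B, -, hB⟩ := exists_abs_inputCoeff_le ξ β
    refine Summable.of_norm_bounded (hnorm.mul_left B) fun i => ?_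
    rw [norm_smul]
    exact mul_le_mul_of_nonneg_right (hB i l) (norm_nonneg _)
  have heq : ∑' i, inputCoeff ξ β i l • kernelOp k (cosBasis i) = inputSection ξ β k l := by
    refine hilbertBasis_ext cosBasis fun j => ?_
    have h1 := (hs.hasSum.mapL (innerSL ℝ (cosBasis j))).tsum_eq
    simp only [innerSL_apply_apply] at h1
    rw [← h1]
    -- the `j`-th coordinate of `P(x, ·)` is a continuous function of `x`
    have hcoef : ∀ i, inner ℝ (cosBasis i) (toState (kernelFun k (cosBasis j))) =
        inner ℝ (cosBasis j) (kernelOp k (cosBasis i)) := fun i => by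
      rw [← kernelOp_apply, real_inner_comm, inner_kernelOp_comm hks, real_inner_comm]
    have hsj : Summable fun i =>
        |inner ℝ (cosBasis i) (toState (kernelFun k (cosBasis j)))| := by
      refine Summable.of_nonneg_of_le (fun _ => abs_nonneg _) (fun i => ?_) hnorm
      rw [hcoef]
      refine (abs_real_inner_le_norm _ _).trans ?_
      rw [cosBasis.orthonormal.1, one_mul]
    have h2 := ((hasSum_cosine_series _ hsj (hξ l)).mul_left (β l)).tsum_eq
    rw [inputSection, inner_smul_right, real_inner_comm, ← kernelFun_apply, ← h2]
    refine tsum_congr fun i => ?_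
    rw [inner_smul_right, hcoef, inputCoeff]
    ring
  rw [← heq]
  exact hs.hasSum

end Riccati

/-! ### The cost as a limit over finite horizons -/

theorem aestronglyMeasurable_Ioi {E : Type*} [TopologicalSpace E]
    [TopologicalSpace.PseudoMetrizableSpace E] {f : ℝ → E}
    (h : ∀ T : ℝ, AEStronglyMeasurable f (volume.restrict (Ioc 0 T))) :
    AEStronglyMeasurable f (volume.restrict (Ioi 0)) := by
  have h1 : Ioi (0 : ℝ) = ⋃ n : ℕ, Ioc 0 (n : ℝ) := by
    ext x
    simp only [mem_Ioi, mem_iUnion, mem_Ioc, exists_and_left]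
    exact ⟨fun hx => ⟨hx, exists_nat_ge x⟩, fun hx => hx.1⟩
  rw [h1, aestronglyMeasurable_iUnion_iff]
  exact fun n => h n

theorem tendsto_ofReal_intervalIntegral {f : ℝ → ℝ} (hf : ∀ s, 0 ≤ f s)
    (hint : ∀ T, 0 ≤ T → IntervalIntegrable f volume 0 T) :
    Tendsto (fun T : ℝ => ENNReal.ofReal (∫ s in (0 : ℝ)..T, f s)) atTop
      (𝓝 (∫⁻ s in Ioi (0 : ℝ), ENNReal.ofReal (f s))) := by
  have hm : AEStronglyMeasurable f (volume.restrict (Ioi 0)) := by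
    refine aestronglyMeasurable_Ioi fun T => ?_
    rcases le_total 0 T with hT | hT
    · exact ((intervalIntegrable_iff_integrableOn_Ioc_of_le hT).1 (hint T hT)).1
    · rw [Ioc_eq_empty (not_lt.2 hT), Measure.restrict_empty]
      exact aestronglyMeasurable_zero_measure f
  have h1 := (aecover_Iic (μ := volume.restrict (Ioi (0 : ℝ)))
    (tendsto_id (α := ℝ) (x := atTop))).lintegral_tendsto_of_countably_generated
    hm.aemeasurable.ennreal_ofReal
  refine h1.congr' ?_
  filter_upwards [eventually_ge_atTop (0 : ℝ)] with T hT
  rw [id, Measure.restrict_restrict measurableSet_Iic, inter_comm, Ioi_inter_Iic,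
    intervalIntegral.integral_of_le hT, ofReal_integral_eq_lintegral_ofReal
    ((intervalIntegrable_iff_integrableOn_Ioc_of_le hT).1 (hint T hT))
    (Eventually.of_forall hf)]

/-! ### Quadratic forms of the control -/

section Control

variable {ι : Type*} [Fintype ι]

theorem integrable_dotProduct_mulVec {μ : Measure ℝ} {u : ℝ → ι → ℝ} (hu : MemLp u 2 μ)
    (A : Matrix ι ι ℝ) : Integrable (fun s => u s ⬝ᵥ A.mulVec (u s)) μ := by
  simp only [dotProduct, Matrix.mulVec, Finset.mul_sum]
  refine integrable_finsetSum _ fun i _ => integrable_finsetSum _ fun j _ => ?_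
  exact (hu.eval i).integrable_mul ((hu.eval j).const_mul (A i j))

theorem posDef_nonneg {R : Matrix ι ι ℝ} (hR : R.PosDef) (v : ι → ℝ) :
    0 ≤ v ⬝ᵥ R.mulVec v := by
  simpa using hR.posSemidef.dotProduct_mulVec_nonneg v

theorem exists_coercive {R : Matrix ι ι ℝ} (hR : R.PosDef) :
    ∃ c > 0, ∀ v : ι → ℝ, c * ‖v‖ ^ 2 ≤ v ⬝ᵥ R.mulVec v := by
  by_cases hne : (Metric.sphere (0 : ι → ℝ) 1).Nonempty
  · have hcont : Continuous fun v : ι → ℝ => v ⬝ᵥ R.mulVec v := by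
      simp only [dotProduct, Matrix.mulVec]
      fun_prop
    obtain ⟨v₀, hv₀, hmin⟩ := (isCompact_sphere (0 : ι → ℝ) 1).exists_isMinOn hne
      hcont.continuousOn
    have hne0 : v₀ ≠ 0 := by
      rintro rfl
      simp at hv₀
    refine ⟨v₀ ⬝ᵥ R.mulVec v₀, by simpa using hR.dotProduct_mulVec_pos hne0, fun v => ?_⟩
    rcases eq_or_ne v 0 with rfl | hv
    · simp
    · have hn : ‖v‖ ≠ 0 := norm_ne_zero_iff.2 hv
      have h1 := hmin (show ‖v‖⁻¹ • v ∈ Metric.sphere (0 : ι → ℝ) 1 by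
        simp [norm_smul, hn])
      simp only [mem_ofPred_eq, Matrix.mulVec_smul, smul_dotProduct, dotProduct_smul,
        smul_eq_mul] at h1
      have h2 := mul_le_mul_of_nonneg_right h1 (sq_nonneg ‖v‖)
      have h3 : ‖v‖⁻¹ * (‖v‖⁻¹ * (v ⬝ᵥ R.mulVec v)) * ‖v‖ ^ 2 = v ⬝ᵥ R.mulVec v := by
        field_simp
      linarith
  · refine ⟨1, one_pos, fun v => ?_⟩
    have hv : v = 0 := by
      by_contra hv
      refine hne ⟨‖v‖⁻¹ • v, ?_⟩
      simp [norm_smul, norm_ne_zero_iff.2 hv]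
    simp [hv]

theorem completing_square [DecidableEq ι] {R : Matrix ι ι ℝ} (hR : R.PosDef) (v g : ι → ℝ) :
    (v + R⁻¹.mulVec g) ⬝ᵥ R.mulVec (v + R⁻¹.mulVec g) =
      v ⬝ᵥ R.mulVec v + 2 * (v ⬝ᵥ g) + g ⬝ᵥ R⁻¹.mulVec g := by
  have hdet : IsUnit R.det := (Matrix.isUnit_iff_isUnit_det R).1 hR.isUnit
  have h1 : R.mulVec (R⁻¹.mulVec g) = g := by
    rw [Matrix.mulVec_mulVec, Matrix.mul_nonsing_inv _ hdet, Matrix.one_mulVec]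
  have hsym : R.transpose = R := by
    have := hR.isHermitian
    rwa [Matrix.IsHermitian, Matrix.conjTranspose_eq_transpose_of_trivial] at this
  have h2 : R⁻¹.mulVec g ⬝ᵥ R.mulVec v = v ⬝ᵥ g := by
    rw [Matrix.dotProduct_mulVec, ← Matrix.mulVec_transpose, hsym, h1, dotProduct_comm]
  rw [Matrix.mulVec_add, h1, add_dotProduct, dotProduct_add, dotProduct_add, h2,
    dotProduct_comm (R⁻¹.mulVec g) g]
  ring

end Control

/-! ### Feedback and the energy identity -/

section Rod

variable {m : ℕ} {ξ β : Fin (m + 1) → ℝ} {Q : ℝ → ℝ} {R : Matrix (Fin (m + 1)) (Fin (m + 1)) ℝ}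
  {P : ℝ → ℝ → ℝ} {k : BoundedContinuousFunction (ℝ × ℝ) ℝ} {M : RodState →L[ℝ] RodState}
  {z₀ : RodState} {v : ℝ → Fin (m + 1) → ℝ} {w : ℝ → RodState}

/-- The feedback gain `-R⁻¹ G` as a vector of elements of `L²(0,1)`. -/
noncomputable def gainVector {H ι : Type*} [NormedAddCommGroup H] [InnerProductSpace ℝ H]
    [Fintype ι] (A : Matrix ι ι ℝ) (G : ι → H) (i : ι) : H :=
  -∑ j, A i j • G j

theorem inner_gainVector {H ι : Type*} [NormedAddCommGroup H] [InnerProductSpace ℝ H]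
    [Fintype ι] (A : Matrix ι ι ℝ) (G : ι → H) (i : ι) (x : H) :
    inner ℝ (gainVector A G i) x = -(A.mulVec fun j => inner ℝ (G j) x) i := by
  simp only [gainVector, inner_neg_left, sum_inner, inner_smul_left, conj_trivial, Matrix.mulVec,
    dotProduct]

theorem feedback_apply (hξ : ∀ i, ξ i ∈ Icc (0 : ℝ) 1)
    (hk : ∀ x ∈ Icc (0 : ℝ) 1, ∀ y ∈ Icc (0 : ℝ) 1, k (x, y) = P x y) (z : ℝ → RodState) (t : ℝ)
    (i : Fin (m + 1)) :
    feedback (gain ξ β R P) z t i = inner ℝ (gainVector R⁻¹ (inputSection ξ β k) i) (z t) := by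
  rw [inner_gainVector, feedback]
  generalize hA : R⁻¹ = A
  have hint : ∀ j, Integrable (fun x => β j * k (ξ j, x) * z t x) rodMeasure := fun j => by
    have h1 : Integrable (z t) rodMeasure := (Lp.memLp (z t)).integrable (by norm_num)
    refine h1.bdd_mul (c := ‖β j‖ * ‖k‖)
      (by fun_prop : Continuous fun x => β j * k (ξ j, x)).aestronglyMeasurable
      (Eventually.of_forall fun x => ?_)
    rw [norm_mul]
    exact mul_le_mul_of_nonneg_left (k.norm_coe_le_norm _) (norm_nonneg _)
  have h1 : ∀ x ∈ Icc (0 : ℝ) 1, gain ξ β R P x i * z t x =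
      -∑ j, A i j * (β j * k (ξ j, x) * z t x) := fun x hx => by
    simp only [gain, hA, Pi.neg_apply, Matrix.mulVec, dotProduct, Matrix.mul_diagonal, Pbar,
      neg_mul, Finset.sum_mul]
    congr 1
    refine Finset.sum_congr rfl fun j _ => ?_
    rw [hk _ (hξ j) _ hx]
    ring
  rw [integral_rod_congr h1, integral_neg, integral_finsetSum _ fun j _ => (hint j).const_mul _,
    Matrix.mulVec, dotProduct]
  congr 1
  refine Finset.sum_congr rfl fun j _ => ?_
  rw [integral_const_mul, inner_inputSection_toState hξ hk]
  congr 1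
  exact integral_rod_congr fun x hx => by rw [hk _ (hξ j) _ hx]

/-- Closed loop trajectories exist. -/
theorem exists_closedLoop (hξ : ∀ i, ξ i ∈ Icc (0 : ℝ) 1)
    (hk : ∀ x ∈ Icc (0 : ℝ) 1, ∀ y ∈ Icc (0 : ℝ) 1, k (x, y) = P x y) (z₀ : RodState) :
    ∃ z, IsTrajectory ξ β z₀ (feedback (gain ξ β R P) z) z := by
  set K := gainVector R⁻¹ (inputSection ξ β k)
  obtain ⟨B, hB0, hB⟩ := exists_abs_inputCoeff_le ξ β
  have hsum : Summable fun n => (eigenvalue n + 1)⁻¹ := by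
    refine (summable_nat_add_iff 1).1 (Summable.of_nonneg_of_le
      (fun n => inv_nonneg.2 (by linarith [eigenvalue_nonneg (n + 1)])) (fun n => ?_)
      ((summable_nat_add_iff 1).2 summable_inv_eigenvalue))
    exact inv_anti₀ (eigenvalue_pos n.succ_ne_zero) (by linarith)
  have hℓ : ∀ n x, (∑ i, inputCoeff ξ β n i • innerSL ℝ (K i)) x =
      inputCoeff ξ β n ⬝ᵥ fun i => inner ℝ (K i) x := fun n x => by
    simp only [sum_apply, smul_apply, innerSL_apply_apply, smul_eq_mul, dotProduct]
  obtain ⟨z, hzc, hz0, hz⟩ := exists_modal_solution cosBasis eigenvalue_nonneg hsum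
    (fun n => ∑ i, inputCoeff ξ β n i • innerSL ℝ (K i)) (C := ∑ i, B * ‖K i‖)
    (Finset.sum_nonneg fun i _ => by positivity) (fun n x => by
      rw [hℓ, dotProduct, Finset.sum_mul]
      refine (Finset.abs_sum_le_sum_abs _ _).trans (Finset.sum_le_sum fun i _ => ?_)
      rw [abs_mul, mul_assoc]
      exact mul_le_mul (hB n i) (abs_real_inner_le_norm _ _) (abs_nonneg _) hB0) z₀
  have hfb : feedback (gain ξ β R P) z = fun t i => inner ℝ (K i) (z t) :=
    funext fun t => funext fun i => feedback_apply hξ hk z t i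
  have hmod : IsModalTrajectory cosBasis eigenvalue (inputCoeff ξ β)
      (feedback (gain ξ β R P) z) z := by
    refine ⟨fun T => ?_, hzc.continuousOn, fun n t ht => ?_⟩
    · have hc : Continuous (feedback (gain ξ β R P) z) := by
        rw [hfb]
        fun_prop
      obtain ⟨c, hcb⟩ := (isCompact_Icc (a := (0 : ℝ)) (b := T)).exists_bound_of_continuousOn
        hc.continuousOn
      refine MemLp.of_bound hc.aestronglyMeasurable c ?_
      exact (ae_restrict_iff' measurableSet_Ioc).2
        (Eventually.of_forall fun s hs => hcb s (Ioc_subset_Icc_self hs))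
    · rw [hz n t ht, hz0]
      simp only [hℓ, hfb]
  exact ⟨z, hz0 ▸ hmod.isTrajectory hξ⟩

theorem IsTrajectory.memLp_sub_feedback (h : IsTrajectory ξ β z₀ v w)
    (K : Fin (m + 1) → RodState) (t : ℝ) :
    MemLp (fun s => v s - fun i => inner ℝ (K i) (w s)) 2 (volume.restrict (Ioc 0 t)) := by
  have hc : ContinuousOn (fun s => fun i => inner ℝ (K i) (w s)) (Icc 0 t) :=
    continuousOn_pi.2 fun i =>
      continuousOn_const.inner (h.continuousOn.mono Icc_subset_Ici_self)
  obtain ⟨c, hcb⟩ := isCompact_Icc.exists_bound_of_continuousOn hc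
  refine (h.control_memLp t).sub (MemLp.of_bound
    ((hc.mono Ioc_subset_Icc_self).aestronglyMeasurable measurableSet_Ioc) c ?_)
  exact (ae_restrict_iff' measurableSet_Ioc).2
    (Eventually.of_forall fun s hs => hcb s (Ioc_subset_Icc_self hs))

/-- The integrand `⟨w, M w⟩ + v' R v` of the cost, `M` being multiplication by `Q`. -/
noncomputable def runningCost (M : RodState →L[ℝ] RodState)
    (R : Matrix (Fin (m + 1)) (Fin (m + 1)) ℝ) (v : ℝ → Fin (m + 1) → ℝ) (w : ℝ → RodState)
    (s : ℝ) : ℝ :=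
  inner ℝ (M (w s)) (w s) + v s ⬝ᵥ R.mulVec (v s)

theorem intervalIntegrable_control_sq (h : IsTrajectory ξ β z₀ v w)
    (K : Fin (m + 1) → RodState) {t : ℝ} (ht : 0 ≤ t) :
    IntervalIntegrable (fun s => (v s - fun i => inner ℝ (K i) (w s)) ⬝ᵥ
      R.mulVec (v s - fun i => inner ℝ (K i) (w s))) volume 0 t := by
  rw [intervalIntegrable_iff_integrableOn_Ioc_of_le ht]
  exact integrable_dotProduct_mulVec (h.memLp_sub_feedback K t) R

theorem intervalIntegrable_runningCost (h : IsTrajectory ξ β z₀ v w) {t : ℝ} (ht : 0 ≤ t) :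
    IntervalIntegrable (runningCost M R v w) volume 0 t := by
  have hc := h.isModalTrajectory.continuousOn_uIcc ht
  refine IntervalIntegrable.add (ContinuousOn.intervalIntegrable
    ((M.continuous.comp_continuousOn hc).inner hc)) ?_
  rw [intervalIntegrable_iff_integrableOn_Ioc_of_le ht]
  exact integrable_dotProduct_mulVec (h.control_memLp t) R

/-- The energy identity: up to the terminal term, the cost over a finite horizon exceeds the value
`⟨P z₀, z₀⟩` by the quadratic deviation of the control from the feedback law. -/
theorem energy_identity (h : IsTrajectory ξ β z₀ v w) (hP : IsWeakRiccatiSolution ξ β Q R P)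
    (hξ : ∀ i, ξ i ∈ Icc (0 : ℝ) 1) (hR : R.PosDef)
    (hk : ∀ x ∈ Icc (0 : ℝ) 1, ∀ y ∈ Icc (0 : ℝ) 1, k (x, y) = P x y)
    (hks : ∀ x y, k (x, y) = k (y, x))
    (hM : ∀ f g, inner ℝ (M f) g = ∫ x, g x * Q x * f x ∂rodMeasure) {t : ℝ} (ht : 0 ≤ t) :
    ∫ s in (0 : ℝ)..t, runningCost M R v w s = quadForm P z₀ - quadForm P (w t) +
      ∫ s in (0 : ℝ)..t, (v s - feedback (gain ξ β R P) w s) ⬝ᵥ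
        R.mulVec (v s - feedback (gain ξ β R P) w s) := by
  have hPD := hP.lyapunov hξ hR.isHermitian hk hks hM
  have hid := h.isModalTrajectory.inner_map_eq (kernelOp k) _ (inputSection ξ β k)
    (inner_kernelOp_comm hks) hPD (hasSum_inputCoeff_smul hξ hks hPD) ht
  rw [h.initial, ← quadForm_eq hk, ← quadForm_eq hk] at hid
  have hfb : ∀ s, feedback (gain ξ β R P) w s =
      fun i => inner ℝ (gainVector R⁻¹ (inputSection ξ β k) i) (w s) :=
    fun s => funext fun i => feedback_apply hξ hk w s i
  have i1 := intervalIntegrable_runningCost (M := M) (R := R) h ht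
  have i2 := intervalIntegrable_control_sq (R := R) h
    (gainVector R⁻¹ (inputSection ξ β k)) ht
  simp only [hfb]
  rw [hid, sub_add_cancel_left, ← sub_eq_iff_eq_add, ← intervalIntegral.integral_sub i1 i2,
    ← intervalIntegral.integral_neg]
  refine intervalIntegral.integral_congr fun s _ => ?_
  have h1 : v s - (fun i => inner ℝ (gainVector R⁻¹ (inputSection ξ β k) i) (w s)) =
      v s + R⁻¹.mulVec fun j => inner ℝ (inputSection ξ β k j) (w s) := by
    funext i
    simp only [inner_gainVector, Pi.sub_apply, Pi.add_apply, sub_neg_eq_add]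
  have h2 : ∑ i, v s i * inner ℝ (inputSection ξ β k i) (w s) =
      v s ⬝ᵥ fun j => inner ℝ (inputSection ξ β k j) (w s) := rfl
  rw [h1, completing_square hR, inner_riccatiOp, h2, runningCost]
  ring

theorem cost_eq (hM : ∀ f g, inner ℝ (M f) g = ∫ x, g x * Q x * f x ∂rodMeasure)
    (v : ℝ → Fin (m + 1) → ℝ) (w : ℝ → RodState) :
    cost Q R v w = ∫⁻ t in Ioi (0 : ℝ), ENNReal.ofReal (runningCost M R v w t) := by
  simp only [cost, runningCost, hM]

theorem inner_mulOp_nonneg (hQ0 : ∀ x ∈ Icc (0 : ℝ) 1, 0 ≤ Q x)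
    (hM : ∀ f g, inner ℝ (M f) g = ∫ x, g x * Q x * f x ∂rodMeasure) (f : RodState) :
    0 ≤ inner ℝ (M f) f := by
  rw [hM]
  refine setIntegral_nonneg measurableSet_Icc fun x hx => ?_
  nlinarith [hQ0 x hx, mul_nonneg (hQ0 x hx) (sq_nonneg (f x))]

/-- A trajectory of finite cost tends to zero unless `Q` vanishes almost everywhere. -/
theorem tendsto_zero_of_cost_lt_top (h : IsTrajectory ξ β z₀ v w) (hR : R.PosDef)
    (hQ0 : ∀ x ∈ Icc (0 : ℝ) 1, 0 ≤ Q x) (hQ : 0 < ∫ x, Q x ∂rodMeasure)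
    (hM : ∀ f g, inner ℝ (M f) g = ∫ x, g x * Q x * f x ∂rodMeasure)
    (hfin : cost Q R v w < ⊤) : Tendsto w atTop (𝓝 0) := by
  have hmod := h.isModalTrajectory
  have hvm : AEStronglyMeasurable v (volume.restrict (Ioi 0)) :=
    aestronglyMeasurable_Ioi fun T => (h.control_memLp T).1
  have hwm : ContinuousOn w (Ioi 0) := h.continuousOn.mono Ioi_subset_Ici_self
  have hMm : AEStronglyMeasurable (fun s => inner ℝ (M (w s)) (w s))
      (volume.restrict (Ioi 0)) :=
    ((M.continuous.comp_continuousOn hwm).inner hwm).aestronglyMeasurable measurableSet_Ioi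
  have hM0 := inner_mulOp_nonneg hQ0 hM
  have hrun : IntegrableOn (runningCost M R v w) (Ioi 0) := by
    refine ⟨hMm.add ?_, ?_⟩
    · have : Continuous fun v : Fin (m + 1) → ℝ => v ⬝ᵥ R.mulVec v := by
        simp only [dotProduct, Matrix.mulVec]
        fun_prop
      exact this.comp_aestronglyMeasurable hvm
    · have hrun0 : ∀ s, 0 ≤ runningCost M R v w s := fun s =>
        add_nonneg (hM0 _) (posDef_nonneg hR _)
      rw [hasFiniteIntegral_iff_ofReal (Eventually.of_forall hrun0), ← cost_eq hM]
      exact hfin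
  have hMi : IntegrableOn (fun s => inner ℝ (M (w s)) (w s)) (Ioi 0) := by
    refine hrun.mono' hMm (Eventually.of_forall fun s => ?_)
    rw [Real.norm_of_nonneg (hM0 _), runningCost]
    linarith [posDef_nonneg hR (v s)]
  have hv : MemLp v 2 (volume.restrict (Ioi 0)) := by
    rw [memLp_two_iff_integrable_sq_norm hvm]
    obtain ⟨c, hc, hcv⟩ := exists_coercive hR
    refine (hrun.const_mul c⁻¹).mono' (hvm.norm.pow 2) (Eventually.of_forall fun s => ?_)
    rw [Real.norm_of_nonneg (sq_nonneg _), inv_mul_eq_div, le_div_iff₀' hc, runningCost]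
    linarith [hcv (v s), hM0 (w s)]
  obtain ⟨B, -, hB⟩ := exists_abs_inputCoeff_le ξ β
  refine hmod.tendsto_zero (fun n hn => eigenvalue_pos hn) summable_inv_eigenvalue hB hv M hM0
    ?_ hMi
  have h1 : inner ℝ (M (cosBasis 0)) (cosBasis 0) = ∫ x, Q x ∂rodMeasure := by
    rw [hM]
    refine integral_congr_ae ?_
    rw [cosBasis_apply]
    filter_upwards [coeFn_toState (cosMode 0)] with x hx
    rw [hx]
    simp [cosMode_apply]
  rwa [h1]

end Rod

end RodLQR

theorem mainTheorem2 {m : ℕ}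
    -- the points `0 = ξ_0 < … < ξ_m = 1` and the actuator strengths
    (ξ β : Fin (m + 1) → ℝ) (hξ : StrictMono ξ) (hξ0 : ξ 0 = 0) (hξ1 : ξ (Fin.last m) = 1)
    (hβ : ∀ k, 0 ≤ β k)
    -- the weights
    (Q : ℝ → ℝ) (hQm : AEMeasurable Q rodMeasure)
    (hQ0 : ∀ x ∈ Set.Icc (0 : ℝ) 1, 0 ≤ Q x) (hQb : ∃ C, ∀ x ∈ Set.Icc (0 : ℝ) 1, Q x ≤ C)
    (R : Matrix (Fin (m + 1)) (Fin (m + 1)) ℝ) (hR : R.PosDef)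
    -- a continuous symmetric weak solution of the Riccati PDE
    (P : ℝ → ℝ → ℝ)
    (hPc : ContinuousOn (fun p : ℝ × ℝ => P p.1 p.2) (Set.Icc 0 1 ×ˢ Set.Icc 0 1))
    (hPs : ∀ x ∈ Set.Icc (0 : ℝ) 1, ∀ y ∈ Set.Icc (0 : ℝ) 1, P x y = P y x)
    (hP : IsWeakRiccatiSolution ξ β Q R P)
    (z₀ : RodState) :
    -- the closed loop system `u = ∫ K z` has a trajectory from `z₀`
    (∃ z, IsTrajectory ξ β z₀ (feedback (gain ξ β R P) z) z) ∧
    -- if it tends to zero, it is optimal among all controls that steer `z₀` to zero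
    (∀ z, IsTrajectory ξ β z₀ (feedback (gain ξ β R P) z) z →
      Filter.Tendsto z Filter.atTop (nhds 0) →
        0 ≤ quadForm P z₀ ∧
        cost Q R (feedback (gain ξ β R P) z) z = ENNReal.ofReal (quadForm P z₀) ∧
        ∀ v w, IsTrajectory ξ β z₀ v w → Filter.Tendsto w Filter.atTop (nhds 0) →
          cost Q R (feedback (gain ξ β R P) z) z ≤ cost Q R v w) ∧
    -- if `Q` is not almost everywhere zero and `P` is positive semidefinite, then it does tend to
    -- zero and is optimal among all controls
    (0 < ∫ x, Q x ∂rodMeasure → (∀ f : RodState, 0 ≤ quadForm P f) →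
      ∀ z, IsTrajectory ξ β z₀ (feedback (gain ξ β R P) z) z →
        Filter.Tendsto z Filter.atTop (nhds 0) ∧
        cost Q R (feedback (gain ξ β R P) z) z = ENNReal.ofReal (quadForm P z₀) ∧
        ∀ v w, IsTrajectory ξ β z₀ v w →
          cost Q R (feedback (gain ξ β R P) z) z ≤ cost Q R v w) := by
  have hξm : ∀ i, ξ i ∈ Icc (0 : ℝ) 1 := fun i =>
    ⟨hξ0 ▸ hξ.monotone (Fin.zero_le i), hξ1 ▸ hξ.monotone (Fin.le_last i)⟩
  obtain ⟨k, hk, hks⟩ := exists_kernel hPc hPs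
  obtain ⟨C, hC⟩ := hQb
  obtain ⟨M, hM⟩ := exists_mulOp hQm fun x hx => (abs_of_nonneg (hQ0 x hx)).trans_le (hC x hx)
  have hrun : ∀ v w s, 0 ≤ runningCost M R v w s := fun v w s =>
    add_nonneg (inner_mulOp_nonneg hQ0 hM _) (posDef_nonneg hR _)
  have hcost : ∀ {v w}, IsTrajectory ξ β z₀ v w →
      Tendsto (fun T => ENNReal.ofReal (∫ s in (0 : ℝ)..T, runningCost M R v w s)) atTop
        (𝓝 (cost Q R v w)) := fun h => by
    rw [cost_eq hM]
    exact tendsto_ofReal_intervalIntegral (hrun _ _) fun T hT => intervalIntegrable_runningCost h hT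
  have hclosed : ∀ {z}, IsTrajectory ξ β z₀ (feedback (gain ξ β R P) z) z → ∀ T, 0 ≤ T →
      ∫ s in (0 : ℝ)..T, runningCost M R (feedback (gain ξ β R P) z) z s =
        quadForm P z₀ - quadForm P (z T) := fun h T hT => by
    rw [energy_identity h hP hξm hR hk hks hM hT]
    simp
  have hopen : ∀ {v w}, IsTrajectory ξ β z₀ v w → ∀ T, 0 ≤ T → quadForm P z₀ - quadForm P (w T) ≤
      ∫ s in (0 : ℝ)..T, runningCost M R v w s := fun h T hT => by
    rw [energy_identity h hP hξm hR hk hks hM hT, le_add_iff_nonneg_right]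
    exact intervalIntegral.integral_nonneg hT fun s _ => posDef_nonneg hR _
  have hterm : ∀ {w : ℝ → RodState}, Tendsto w atTop (𝓝 0) →
      Tendsto (fun T => quadForm P z₀ - quadForm P (w T)) atTop (𝓝 (quadForm P z₀)) :=
    fun {w} hw => by
    simp only [quadForm_eq hk]
    have h1 : Continuous fun f => inner ℝ (kernelOp k f) f := by fun_prop
    have h2 := ((h1.tendsto 0).comp hw).const_sub (inner ℝ (kernelOp k z₀) z₀)
    simpa only [map_zero, inner_zero_left, sub_zero, Function.comp_def] using h2
  have optimal_of_tendsto : ∀ z, IsTrajectory ξ β z₀ (feedback (gain ξ β R P) z) z →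
      Tendsto z atTop (𝓝 0) →
        0 ≤ quadForm P z₀ ∧
        cost Q R (feedback (gain ξ β R P) z) z = ENNReal.ofReal (quadForm P z₀) ∧
        ∀ v w, IsTrajectory ξ β z₀ v w → Tendsto w atTop (𝓝 0) →
          cost Q R (feedback (gain ξ β R P) z) z ≤ cost Q R v w := by
    intro z hz hz0
    have hlim := (hterm hz0).congr' (by
      filter_upwards [eventually_ge_atTop (0 : ℝ)] with T hT
      exact (hclosed hz T hT).symm)
    have hval : cost Q R (feedback (gain ξ β R P) z) z = ENNReal.ofReal (quadForm P z₀) :=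
      tendsto_nhds_unique (hcost hz) (ENNReal.tendsto_ofReal hlim)
    refine ⟨ge_of_tendsto hlim ?_, hval, fun v w hw hw0 => ?_⟩
    · filter_upwards [eventually_ge_atTop (0 : ℝ)] with T hT
      exact intervalIntegral.integral_nonneg hT fun s _ => hrun _ _ s
    · rw [hval]
      refine le_of_tendsto_of_tendsto (ENNReal.tendsto_ofReal (hterm hw0)) (hcost hw) ?_
      filter_upwards [eventually_ge_atTop (0 : ℝ)] with T hT
      exact ENNReal.ofReal_le_ofReal (hopen hw T hT)
  refine ⟨exists_closedLoop hξm hk z₀, optimal_of_tendsto, fun hQ hpsd z hz => ?_⟩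
  have hfin : cost Q R (feedback (gain ξ β R P) z) z < ⊤ := by
    refine lt_of_le_of_lt (le_of_tendsto (hcost hz) ?_)
      (ENNReal.ofReal_lt_top (r := quadForm P z₀))
    filter_upwards [eventually_ge_atTop (0 : ℝ)] with T hT
    rw [hclosed hz T hT]
    exact ENNReal.ofReal_le_ofReal (by linarith [hpsd (z T)])
  have hz0 := tendsto_zero_of_cost_lt_top hz hR hQ0 hQ hM hfin
  obtain ⟨-, hval, hmin⟩ := optimal_of_tendsto z hz hz0
  refine ⟨hz0, hval, fun v w hw => ?_⟩
  -- a competitor of finite cost tends to zero, one of infinite cost is no competitor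
  rcases lt_or_eq_of_le (le_top (a := cost Q R v w)) with hlt | heq
  · exact hmin v w hw (tendsto_zero_of_cost_lt_top hw hR hQ0 hQ hM hlt)
  · rw [heq]
    exact le_top
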